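/- Let $\mathbb C_v$ be either the field $\mathbb C$ of complex numbers with its usual absolute value, or, for a prime number $p$, the field $\mathbb C_p$ (the completion of an algebraic closure of $\mathbb Q_p$) with its $p$-adic absolute value. Let $d\ge 2$ be an integer and let $U,V\in\mathbb C_v[X,Y]$ be homogeneous polynomials of degree $d$ with no common zero in $\mathbb C_v^2$ other than $(0,0)$. Let $F:\mathbb C_v^2\to\mathbb C_v^2$ be the map $F(x,y)=(U(x,y),V(x,y))$, and let $$\mathscr J_v=\{z\in\mathbb C_v^2 : \text{the sequence } (F^{n}(z))_{n\ge 0} \text{ is bounded}\}$$ be the homogeneous filled Julia set of $f=[U:V]$. For $z_1=(x_1,y_1)$ and $z_2=(x_2,y_2)$ in $\mathbb C_v^2$ put $d(z_1,z_2)=|x_1y_2-x_2y_1|$, and for a bounded set $K\subset\mathbb C_v^2$ define its homogeneous transfinite diameter by $$\delta^h(K)=\lim_{n\to\infty}\ \sup_{z_1,\dots,z_n\in K}\ \prod_{\substack{1\le i,j\le n\\ i\ne j}} d(z_i,z_j)^{1/n(n-1)}.$$ Let $\operatorname{Res}(U,V)$ be the resultant of $U$ and $V$, i.e. (up to sign,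 which does not matter here) the determinant in the monomial bases of the linear map $(A,B)\mapsto AU+BV$ from pairs of homogeneous polynomials of degree $d-1$ to homogeneous polynomials of degree $2d-1$. Then $\mathscr J_v$ is bounded, the limit defining $\delta^h(\mathscr J_v)$ exists, and $$\delta^h(\mathscr J_v)=|\operatorname{Res}(U,V)|^{-1/d(d-1)}.$$ -/

import Mathlib

open Filter Topology

noncomputable section

namespace HomogeneousDynamics

variable {K : Type*} [NormedField K]

/-- The map `K² → K²`, `z ↦ (U(z), V(z))`, attached to a pair of polynomials in two variables
(the variables `X`, `Y` have indices `0`, `1`). Its `n`-th iterate is `z ↦ (Uₙ(z), Vₙ(z))`. -/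
def lift (U V : MvPolynomial (Fin 2) K) (z : Fin 2 → K) : Fin 2 → K :=
  ![MvPolynomial.eval z U, MvPolynomial.eval z V]

/-- The homogeneous filled Julia set: the points of `K²` with bounded forward orbit. -/
def filledJulia (U V : MvPolynomial (Fin 2) K) : Set (Fin 2 → K) :=
  {z | Bornology.IsBounded (Set.range fun n : ℕ => (lift U V)^[n] z)}

/-- The polynomial `U(T, 1)`. -/
def dehomogenize (U : MvPolynomial (Fin 2) K) : Polynomial K :=
  MvPolynomial.aeval ![Polynomial.X, 1] U

/-- The resultant of two binary forms `U`, `V` of degree `d`: the determinant of their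
`2d × 2d` Sylvester matrix, that is (up to sign) of `(A, B) ↦ AU + BV` from pairs of forms of
degree `d - 1` to forms of degree `2d - 1` in the monomial bases. The coefficient of `X^i Y^(d-i)`
in a form of degree `d` is the coefficient of `T^i` in its dehomogenization; the formal
degree is `d` for both polynomials, whatever their actual degrees. -/
def formResultant (d : ℕ) (U V : MvPolynomial (Fin 2) K) : K :=
  Polynomial.resultant (dehomogenize U) (dehomogenize V) d d

/-- `d(z, w) = |x₁ y₂ - x₂ y₁|` for `z = (x₁, y₁)`, `w = (x₂, y₂)`. -/
def wedgeDist (z w : Fin 2 → K) : ℝ := ‖z 0 * w 1 - w 0 * z 1‖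

/-- `δₙ(S) = sup_{z₁, …, zₙ ∈ S} ∏_{i ≠ j} d(zᵢ, zⱼ)^(1 / (n (n - 1)))`, the product being over
ordered pairs (meaningful for bounded `S` and `n ≥ 2`). The homogeneous transfinite diameter
of a bounded set `S` is the limit of `δₙ(S)` as `n → ∞`. -/
def transfiniteDiameterSeq (S : Set (Fin 2 → K)) (n : ℕ) : ℝ :=
  sSup ((fun z : Fin n → Fin 2 → K =>
      ∏ p ∈ (Finset.univ : Finset (Fin n)).offDiag,
        wedgeDist (z p.1) (z p.2) ^ (1 / ((n : ℝ) * ((n : ℝ) - 1)))) '' {z | ∀ i, z i ∈ S})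

/-- `δ` is the homogeneous transfinite diameter of `S`: the set `S` is bounded, and the
limit defining its homogeneous transfinite diameter exists and is `δ`. -/
def HasTransfiniteDiameter (S : Set (Fin 2 → K)) (δ : ℝ) : Prop :=
  Bornology.IsBounded S ∧ Tendsto (transfiniteDiameterSeq S) atTop (𝓝 δ)

end HomogeneousDynamics

end

/-! Write `F` for `lift U V`, `S` for the filled Julia set, `R` for the absolute value of the
resultant, and `M n` for the supremum of `pairProd` over `n`-tuples of `S`. The proof rests on
`F⁻¹(S) = S` and on two comparisons of `M (d * m)` with `M m ^ d`, sharp up to factors `exp(o(m²))`.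

From below: a point `w` in general position has `d` preimages `y l`, one on each of `d` lines, with
`∏ d(y l, x) = R^(-1/d) d(w, F x)` (`prod_wedgeDist_fiber`). Pulling back an `m`-tuple therefore
multiplies the `d`-th power of its product by `R^(-(m²-m))` and by the products inside the fibres
(`pairProd_fibers`). The latter are bounded below by a weight that vanishes only on finitely many
lines (`exists_weight_fiber`); sacrificing a fixed number of points absorbs the weights at a cost
exponential in `m` (`exists_dropList`).

From above: the forms `X^a Y^(d-1-a) U^i V^(m-1-i)` are expressed in monomials of degree `dm - 1`.
The squared norm of the transition determinant is `R^(m²-m)`, read off from a single pulled-back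
tuple (`norm_det_transitionMatrix`). Their values at any `dm`-tuple of `S` are controlled by
interpolating at a nearly extremal `m`-tuple (`norm_det_productMatrix_le`).

The normalized suprema decrease and, by roots of unity, stay away from zero, so they have a limit `l
> 0`. Taking logarithms and dividing by `m²` gives `(d² - d) log l = -log R`
(`tendsto_of_pullback_bounds`). No compactness is used, so `ℂ` and `ℂ_p` are treated alike. -/

noncomputable section

namespace HomogeneousDynamics

variable {K : Type*} [NormedField K]

set_option linter.unusedSectionVars false

/-! ### Products of distances, Vandermonde determinants and dropping points -/

section PairProd

variable {ι κ : Type*} [Fintype ι] [DecidableEq ι] [Fintype κ] [DecidableEq κ]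

/-- The determinant `x₁ y₂ - x₂ y₁`. -/
def wedge (z w : Fin 2 → K) : K := z 0 * w 1 - w 0 * z 1

lemma wedgeDist_eq (z w : Fin 2 → K) : wedgeDist z w = ‖wedge z w‖ := rfl

lemma wedgeDist_nonneg (z w : Fin 2 → K) : 0 ≤ wedgeDist z w := norm_nonneg _

lemma wedgeDist_comm (z w : Fin 2 → K) : wedgeDist z w = wedgeDist w z := by
  rw [wedgeDist, wedgeDist, norm_sub_rev]

lemma wedgeDist_le (z w : Fin 2 → K) : wedgeDist z w ≤ 2 * ‖z‖ * ‖w‖ := by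
  have h : ∀ i j, ‖z i‖ * ‖w j‖ ≤ ‖z‖ * ‖w‖ := fun i j =>
    mul_le_mul (norm_le_pi_norm z i) (norm_le_pi_norm w j) (norm_nonneg _) (norm_nonneg _)
  calc wedgeDist z w ≤ ‖z 0 * w 1‖ + ‖w 0 * z 1‖ := norm_sub_le _ _
    _ ≤ 2 * ‖z‖ * ‖w‖ := by
      rw [norm_mul, norm_mul, mul_comm ‖w 0‖]; linarith [h 0 1, h 1 0]

/-- The product of the distances `d(zᵢ, zⱼ)` over ordered pairs `i ≠ j`. -/
def pairProd (z : ι → Fin 2 → K) : ℝ :=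
  ∏ p ∈ (Finset.univ : Finset ι).offDiag, wedgeDist (z p.1) (z p.2)

lemma pairProd_nonneg (z : ι → Fin 2 → K) : 0 ≤ pairProd z :=
  Finset.prod_nonneg fun _ _ => wedgeDist_nonneg _ _

lemma prod_offDiag_eq {M : Type*} [CommMonoid M] (f : ι → ι → M) :
    ∏ p ∈ (Finset.univ : Finset ι).offDiag, f p.1 p.2 =
      ∏ i, ∏ j ∈ Finset.univ.erase i, f i j := by
  rw [Finset.prod_sigma']
  refine Finset.prod_bij' (fun p _ => ⟨p.1, p.2⟩) (fun s _ => (s.1, s.2)) ?_ ?_ ?_ ?_ ?_ <;>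
    simp [eq_comm]

lemma pairProd_comp_equiv (e : κ ≃ ι) (z : ι → Fin 2 → K) : pairProd (z ∘ e) = pairProd z := by
  unfold pairProd
  refine Finset.prod_equiv (e.prodCongr e) ?_ ?_ <;> simp

lemma pairProd_le {z : ι → Fin 2 → K} {C : ℝ} (hz : ∀ i, ‖z i‖ ≤ C) :
    pairProd z ≤ (2 * C * C) ^ (Fintype.card ι * Fintype.card ι - Fintype.card ι) := by
  rw [pairProd, ← Finset.card_univ, ← Finset.offDiag_card]
  refine (Finset.prod_le_prod (fun _ _ => wedgeDist_nonneg _ _) fun p _ => ?_).trans_eq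
    (Finset.prod_const _)
  refine (wedgeDist_le _ _).trans ?_
  have := (norm_nonneg _).trans (hz p.1)
  have h1 := hz p.1
  have h2 := hz p.2
  gcongr

lemma prod_offDiag_eq_sq {n : ℕ} (f : Fin n → Fin n → ℝ) (hf : ∀ i j, f i j = f j i) :
    ∏ p ∈ (Finset.univ : Finset (Fin n)).offDiag, f p.1 p.2 =
      (∏ i : Fin n, ∏ j ∈ Finset.Ioi i, f i j) ^ 2 := by
  have h1 : ∏ i : Fin n, ∏ j ∈ Finset.Ioi i, f i j = ∏ i : Fin n, ∏ j ∈ Finset.Iio i, f i j := by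
    rw [Finset.prod_sigma', Finset.prod_sigma']
    refine Finset.prod_bij' (fun p _ => ⟨p.2, p.1⟩) (fun s _ => ⟨s.2, s.1⟩) ?_ ?_ ?_ ?_ ?_ <;>
      simp [hf]
  rw [prod_offDiag_eq, sq]
  nth_rewrite 2 [h1]
  rw [← Finset.prod_mul_distrib]
  refine Finset.prod_congr rfl fun i _ => ?_
  rw [← Finset.prod_union]
  · congr 1
    ext j
    simp [lt_or_lt_iff_ne, eq_comm]
  · rw [Finset.disjoint_left]
    intro j h1 h2
    simp only [Finset.mem_Ioi, Finset.mem_Iio] at h1 h2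
    exact lt_asymm h1 h2

/-- The vector of all monomials of degree `n - 1` evaluated at `z`. -/
def monomialVec (n : ℕ) (z : Fin 2 → K) (j : Fin n) : K := z 0 ^ (j : ℕ) * z 1 ^ (j.rev : ℕ)

/-- The matrix of the monomials of degree `n - 1` evaluated at `n` points. -/
def formMatrix {n : ℕ} (e : ι ≃ Fin n) (z : ι → Fin 2 → K) : Matrix ι ι K :=
  .of fun p j => monomialVec n (z p) (e j)

/-- The homogeneous Vandermonde determinant runs over unordered pairs and `pairProd` over ordered
ones, hence the square. -/
lemma norm_det_formMatrix_sq {n : ℕ} (e : ι ≃ Fin n) (z : ι → Fin 2 → K) :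
    ‖(formMatrix e z).det‖ ^ 2 = pairProd z := by
  have h : formMatrix e z = (Matrix.projVandermonde (fun i => z (e.symm i) 0)
      (fun i => z (e.symm i) 1)).submatrix e e := by
    ext i j
    simp [formMatrix, monomialVec, Matrix.projVandermonde_apply]
  rw [h, Matrix.det_submatrix_equiv_self, Matrix.det_projVandermonde,
    ← pairProd_comp_equiv e.symm z, pairProd, prod_offDiag_eq_sq
      (fun i j => wedgeDist ((z ∘ e.symm) i) ((z ∘ e.symm) j)) (fun i j => wedgeDist_comm _ _)]
  simp only [norm_prod, wedgeDist, Function.comp_apply]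
  congr 1
  refine Finset.prod_congr rfl fun i _ => Finset.prod_congr rfl fun j _ => norm_sub_rev _ _

lemma formMatrix_update {n : ℕ} (e : ι ≃ Fin n) (z : ι → Fin 2 → K) (k : ι) (b : Fin 2 → K) :
    formMatrix e (Function.update z k b) =
      (formMatrix e z).updateRow k (fun j => monomialVec n b (e j)) := by
  ext i j
  by_cases h : i = k
  · subst h; simp [formMatrix]
  · simp [formMatrix, h]

/-- Lagrange interpolation of forms of degree `n - 1` at `n` points. -/
lemma det_mul_monomialVec {n : ℕ} (e : ι ≃ Fin n) (z : ι → Fin 2 → K) (b : Fin 2 → K)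
    (j : Fin n) :
    (formMatrix e z).det * monomialVec n b j =
      ∑ k, (formMatrix e (Function.update z k b)).det * monomialVec n (z k) j := by
  -- Cramer's rule for the transpose: replacing row `k` amounts to replacing the point `z k` by `b`.
  have h := congrFun (Matrix.mulVec_cramer (formMatrix e z).transpose
    (fun j => monomialVec n b (e j))) (e.symm j)
  simp only [Matrix.mulVec, dotProduct, Matrix.cramer_apply, Matrix.updateCol_transpose,
    Matrix.det_transpose, Matrix.transpose_apply, Pi.smul_apply, smul_eq_mul,
    Equiv.apply_symm_apply] at h
  rw [← h]
  refine Finset.sum_congr rfl fun k _ => ?_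
  rw [formMatrix_update, mul_comm]
  simp [formMatrix]

lemma norm_monomialVec_le {n : ℕ} {z : Fin 2 → K} {C : ℝ} (hz : ‖z‖ ≤ C) (j : Fin n) :
    ‖monomialVec n z j‖ ≤ C ^ (n - 1) := by
  have h : n - 1 = j + j.rev := by rw [Fin.val_rev]; omega
  rw [monomialVec, norm_mul, norm_pow, norm_pow, h, pow_add]
  have h0 := (norm_le_pi_norm z 0).trans hz
  have h1 := (norm_le_pi_norm z 1).trans hz
  have := (norm_nonneg _).trans h0
  gcongr

lemma prod_erase_eq_prod_succAbove {M : Type*} [CommMonoid M] {m : ℕ} (k : Fin (m + 1))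
    (g : Fin (m + 1) → M) : ∏ j ∈ Finset.univ.erase k, g j = ∏ j, g (k.succAbove j) := by
  rw [← Finset.compl_singleton, ← Fin.image_succAbove_univ, Finset.prod_image]
  exact fun _ _ _ _ h => Fin.succAbove_right_injective h

lemma pairProd_update {m : ℕ} (z : Fin (m + 1) → Fin 2 → K) (k : Fin (m + 1)) (b : Fin 2 → K) :
    pairProd (Function.update z k b) =
      pairProd (fun j => z (k.succAbove j)) * ∏ j, wedgeDist (z (k.succAbove j)) b ^ 2 := by
  have key : ∀ f : Fin (m + 1) → Fin (m + 1) → ℝ,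
      ∏ p ∈ (Finset.univ : Finset (Fin (m + 1))).offDiag, f p.1 p.2 =
      (∏ p ∈ (Finset.univ : Finset (Fin m)).offDiag, f (k.succAbove p.1) (k.succAbove p.2)) *
        ((∏ j, f (k.succAbove j) k) * ∏ j, f k (k.succAbove j)) := by
    intro f
    have he' : ∀ (i : Fin m) (g : Fin (m + 1) → ℝ),
        ∏ j ∈ Finset.univ.erase (k.succAbove i), g j =
          g k * ∏ j ∈ Finset.univ.erase i, g (k.succAbove j) := by
      intro i g
      have : (Finset.univ.erase (k.succAbove i) : Finset (Fin (m + 1))) =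
          insert k ((Finset.univ.erase i).image k.succAbove) := by
        ext j
        rcases Fin.eq_self_or_eq_succAbove k j with rfl | ⟨l, rfl⟩
        · simp [(Fin.succAbove_ne _ i).symm]
        · simp [Fin.succAbove_ne]
      rw [this, Finset.prod_insert, Finset.prod_image]
      · exact fun _ _ _ _ h => Fin.succAbove_right_injective h
      · simp [Fin.succAbove_ne]
    rw [prod_offDiag_eq, Fin.prod_univ_succAbove _ k, prod_erase_eq_prod_succAbove,
      prod_offDiag_eq (fun i j => f (k.succAbove i) (k.succAbove j))]
    simp only [he', Finset.prod_mul_distrib]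
    ring
  rw [pairProd, key (fun i j => wedgeDist (Function.update z k b i) (Function.update z k b j))]
  simp only [Function.update_self, Function.update_of_ne (Fin.succAbove_ne k _)]
  rw [pairProd, ← Finset.prod_mul_distrib]
  congr 1
  exact Finset.prod_congr rfl fun j _ => by rw [wedgeDist_comm b, sq]

lemma exists_norm_apply_eq (b : Fin 2 → K) : ∃ i, ‖b i‖ = ‖b‖ := by
  by_contra! h
  have h' : ∀ i, ‖b i‖ < ‖b‖ := fun i => lt_of_le_of_ne (norm_le_pi_norm b i) (h i)
  have : 0 < ‖b‖ := (norm_nonneg _).trans_lt (h' 0)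
  exact lt_irrefl _ ((pi_norm_lt_iff this).2 h')

lemma exists_norm_monomialVec_eq (m : ℕ) (b : Fin 2 → K) :
    ∃ j : Fin (m + 1), ‖monomialVec (m + 1) b j‖ = ‖b‖ ^ m := by
  obtain ⟨i, hi⟩ := exists_norm_apply_eq b
  fin_cases i
  · exact ⟨Fin.last m, by simp [monomialVec, ← hi]⟩
  · exact ⟨0, by simp [monomialVec, ← hi]⟩

/-- Interpolate at `z` the monomial whose value at `b` has norm `‖b‖ ^ m`. The node values are at
most `C ^ m`, so the largest of the `m + 1` determinants must account for its share of the sum. -/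
lemma exists_pairProd_update_ge {m : ℕ} {z : Fin (m + 1) → Fin 2 → K} {C : ℝ}
    (hz : ∀ i, ‖z i‖ ≤ C) (b : Fin 2 → K) :
    ∃ k, pairProd z * (‖b‖ ^ m) ^ 2 ≤
      ((m + 1) * C ^ m) ^ 2 * pairProd (Function.update z k b) := by
  obtain ⟨j, hj⟩ := exists_norm_monomialVec_eq m b
  have hC : 0 ≤ C := (norm_nonneg _).trans (hz 0)
  obtain ⟨k, -, hk⟩ := Finset.exists_max_image Finset.univ
    (fun k => ‖(formMatrix (Equiv.refl _) (Function.update z k b)).det‖) ⟨0, Finset.mem_univ _⟩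
  refine ⟨k, ?_⟩
  rw [← norm_det_formMatrix_sq (Equiv.refl _), ← norm_det_formMatrix_sq (Equiv.refl _), ← mul_pow,
    ← mul_pow]
  refine pow_le_pow_left₀ (by positivity) ?_ 2
  rw [← hj, ← norm_mul, det_mul_monomialVec]
  calc _ ≤ ∑ i : Fin (m + 1), ‖(formMatrix (Equiv.refl _) (Function.update z k b)).det‖ * C ^ m := by
        refine (norm_sum_le _ _).trans (Finset.sum_le_sum fun i _ => ?_)
        rw [norm_mul]
        exact mul_le_mul (hk i (Finset.mem_univ _)) (norm_monomialVec_le (hz i) j)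
          (norm_nonneg _) (norm_nonneg _)
    _ = _ := by simp; ring

/-- Dropping one point of a tuple, a factor `∏ d(w_k, b)²` can be gained at exponential cost. -/
lemma exists_dropOne {S : Set (Fin 2 → K)} {C B : ℝ} (hS : ∀ z ∈ S, ‖z‖ ≤ C)
    {φ : (Fin 2 → K) → ℝ} (hφ0 : ∀ z ∈ S, 0 ≤ φ z) (hφ : ∀ z ∈ S, φ z ≤ B)
    {b : Fin 2 → K} (hb : b ≠ 0) :
    ∃ D : ℝ, 1 ≤ D ∧ ∀ (m : ℕ) (z : Fin (m + 1) → Fin 2 → K), (∀ i, z i ∈ S) →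
      ∃ w : Fin m → Fin 2 → K, (∀ i, w i ∈ S) ∧
        pairProd z * ∏ i, φ (z i) ≤
          D ^ (m + 1) * (pairProd w * ∏ i, (φ (w i) * wedgeDist (w i) b ^ 2)) := by
  have hb' : 0 < ‖b‖ := norm_pos_iff.2 hb
  -- The 4 absorbs `(m + 1)² ≤ 4 ^ m`; `C` may be negative if `S` is empty.
  set E : ℝ := 4 * (max C 0) ^ 2 / ‖b‖ ^ 2 with hE
  have hE0 : 0 ≤ E := by positivity
  refine ⟨max 1 E * max 1 B, ?_, fun m z hz => ?_⟩
  · exact one_le_mul_of_one_le_of_one_le (le_max_left _ _) (le_max_left _ _)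
  obtain ⟨k, hk⟩ := exists_pairProd_update_ge (C := max C 0)
    (fun i => (hS _ (hz i)).trans (le_max_left _ _)) b
  refine ⟨fun j => z (k.succAbove j), fun j => hz _, ?_⟩
  rw [pairProd_update] at hk
  set P := pairProd (fun j => z (k.succAbove j)) with hP
  have hP0 : 0 ≤ P := pairProd_nonneg _
  have h1 : pairProd z ≤ E ^ m * (P * ∏ j, wedgeDist (z (k.succAbove j)) b ^ 2) := by
    have hm : ((m : ℝ) + 1) ^ 2 ≤ 4 ^ m := by
      have : ((m : ℝ) + 1) ≤ 2 ^ m := by exact_mod_cast Nat.lt_two_pow_self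
      calc ((m : ℝ) + 1) ^ 2 ≤ (2 ^ m) ^ 2 := by gcongr
        _ = 4 ^ m := by rw [← pow_mul, mul_comm, pow_mul]; norm_num
    rw [hE, div_pow, div_mul_eq_mul_div, le_div_iff₀ (by positivity)]
    have hQ : 0 ≤ P * ∏ j, wedgeDist (z (k.succAbove j)) b ^ 2 := by positivity
    calc pairProd z * (‖b‖ ^ 2) ^ m = pairProd z * (‖b‖ ^ m) ^ 2 := by
          rw [← pow_mul, ← pow_mul, mul_comm 2]
      _ ≤ ((m + 1) * (max C 0) ^ m) ^ 2 * (P * ∏ j, wedgeDist (z (k.succAbove j)) b ^ 2) := hk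
      _ = (m + 1) ^ 2 * ((max C 0) ^ m) ^ 2 * (P * ∏ j, wedgeDist (z (k.succAbove j)) b ^ 2) := by
          ring
      _ ≤ 4 ^ m * ((max C 0) ^ m) ^ 2 * (P * ∏ j, wedgeDist (z (k.succAbove j)) b ^ 2) := by
          gcongr
      _ = _ := by rw [mul_pow 4, ← pow_mul, ← pow_mul, mul_comm 2]
  rw [Fin.prod_univ_succAbove _ k, Finset.prod_mul_distrib]
  have h2 : 0 ≤ ∏ j, φ (z (k.succAbove j)) := Finset.prod_nonneg fun _ _ => hφ0 _ (hz _)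
  have h3 : φ (z k) ≤ (max 1 B) ^ (m + 1) := by
    refine ((hφ _ (hz k)).trans (le_max_right 1 B)).trans (le_self_pow₀ (le_max_left _ _) ?_)
    omega
  have h4 : E ^ m ≤ max 1 E ^ (m + 1) :=
    (pow_le_pow_left₀ hE0 (le_max_right _ _) m).trans
      (pow_le_pow_right₀ (le_max_left _ _) (Nat.le_succ m))
  have h5 : 0 ≤ ∏ j, wedgeDist (z (k.succAbove j)) b ^ 2 := by positivity
  have h6 := hφ0 _ (hz k)
  calc _ ≤ (E ^ m * (P * ∏ j, wedgeDist (z (k.succAbove j)) b ^ 2)) *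
        (φ (z k) * ∏ j, φ (z (k.succAbove j))) := by gcongr
    _ ≤ (max 1 E ^ (m + 1) * (P * ∏ j, wedgeDist (z (k.succAbove j)) b ^ 2)) *
        (max 1 B ^ (m + 1) * ∏ j, φ (z (k.succAbove j))) := by gcongr
    _ = _ := by rw [mul_pow]; ring

/-- The weight `∏ d(z, b)²` over the members `b` of a list. -/
def weight (L : List (Fin 2 → K)) (z : Fin 2 → K) : ℝ :=
  (L.map fun b => wedgeDist z b ^ 2).prod

lemma weight_nonneg (L : List (Fin 2 → K)) (z : Fin 2 → K) : 0 ≤ weight L z :=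
  List.prod_nonneg (by simp only [List.mem_map]; rintro _ ⟨b, -, rfl⟩; positivity)

lemma exists_weight_le {S : Set (Fin 2 → K)} {C : ℝ} (hS : ∀ z ∈ S, ‖z‖ ≤ C)
    (L : List (Fin 2 → K)) : ∃ B, 1 ≤ B ∧ ∀ z ∈ S, weight L z ≤ B := by
  induction L with
  | nil => exact ⟨1, le_rfl, fun _ _ => by simp [weight]⟩
  | cons b L ih =>
    obtain ⟨B, hB1, hB⟩ := ih
    refine ⟨max 1 ((2 * C * ‖b‖) ^ 2) * B,
      one_le_mul_of_one_le_of_one_le (le_max_left _ _) hB1, fun z hz => ?_⟩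
    have h : wedgeDist z b ≤ 2 * C * ‖b‖ := (wedgeDist_le z b).trans (by have := hS z hz; gcongr)
    have h0 := wedgeDist_nonneg z b
    have h1 := weight_nonneg L z
    have h2 := hB z hz
    calc weight (b :: L) z = wedgeDist z b ^ 2 * weight L z := by simp [weight]
      _ ≤ (2 * C * ‖b‖) ^ 2 * B := by gcongr
      _ ≤ _ := by gcongr; exact le_max_right _ _

/-- Dropping boundedly many points of a tuple, a factor `∏ weight L w_k` can be gained at
exponential cost. -/
lemma exists_dropList {S : Set (Fin 2 → K)} {C : ℝ} (hS : ∀ z ∈ S, ‖z‖ ≤ C)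
    (L : List (Fin 2 → K)) (hL : ∀ b ∈ L, b ≠ 0) :
    ∃ D : ℝ, 1 ≤ D ∧ ∀ (m : ℕ) (z : Fin (m + L.length) → Fin 2 → K), (∀ i, z i ∈ S) →
      ∃ w : Fin m → Fin 2 → K, (∀ i, w i ∈ S) ∧
        pairProd z ≤ D ^ (m + 1) * (pairProd w * ∏ i, weight L (w i)) := by
  induction L with
  | nil => exact ⟨1, le_rfl, fun m z hz => ⟨z, hz, by simp [weight]⟩⟩
  | cons b L ih =>
    obtain ⟨D, hD1, hD⟩ := ih fun c hc => hL c (List.mem_cons_of_mem _ hc)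
    obtain ⟨B, hB1, hB⟩ := exists_weight_le hS L
    obtain ⟨E, hE1, hE⟩ := exists_dropOne hS (fun z _ => weight_nonneg L z) hB
      (hL b List.mem_cons_self)
    -- The points for `L` are dropped first, leaving `m + 1`; the weight of `L` is then the function
    -- `φ` carried along when one more is dropped for `b`. `D ^ 2` covers `D ^ (m + 2)`.
    refine ⟨D ^ 2 * E, one_le_mul_of_one_le_of_one_le (one_le_pow₀ hD1) hE1, fun m z hz => ?_⟩
    have hlen : m + 1 + L.length = m + (b :: L).length := by simp; omega
    obtain ⟨w', hw', h1⟩ := hD (m + 1) (z ∘ finCongr hlen) fun i => hz _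
    rw [pairProd_comp_equiv] at h1
    obtain ⟨w, hw, h2⟩ := hE m w' hw'
    refine ⟨w, hw, ?_⟩
    have hQ : 0 ≤ pairProd w * ∏ i, (weight L (w i) * wedgeDist (w i) b ^ 2) :=
      mul_nonneg (pairProd_nonneg _) (Finset.prod_nonneg fun i _ =>
        mul_nonneg (weight_nonneg _ _) (by positivity))
    calc pairProd z ≤ D ^ (m + 1 + 1) * (pairProd w' * ∏ i, weight L (w' i)) := h1
      _ ≤ (D ^ 2) ^ (m + 1) *
          (E ^ (m + 1) * (pairProd w * ∏ i, (weight L (w i) * wedgeDist (w i) b ^ 2))) := by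
        rw [← pow_mul]
        exact mul_le_mul (pow_le_pow_right₀ hD1 (by omega)) h2 (mul_nonneg (pairProd_nonneg _)
          (Finset.prod_nonneg fun i _ => weight_nonneg _ _)) (by positivity)
      _ = _ := by
        rw [mul_pow, mul_assoc]
        simp only [weight, List.map_cons, List.prod_cons, mul_comm]

end PairProd

/-! ### Growth of the lift; boundedness of the filled Julia set -/

section Julia

lemma exists_norm_eval_le (P : MvPolynomial (Fin 2) K) :
    ∃ C : ℝ, 1 ≤ C ∧ ∀ z : Fin 2 → K, ‖z‖ ≤ 1 → ‖MvPolynomial.eval z P‖ ≤ C := by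
  refine ⟨1 + ∑ s ∈ P.support, ‖P.coeff s‖, le_add_of_nonneg_right (by positivity),
    fun z hz => ?_⟩
  rw [MvPolynomial.eval_eq]
  refine (norm_sum_le _ _).trans (le_add_of_nonneg_of_le zero_le_one
    (Finset.sum_le_sum fun s _ => ?_))
  rw [norm_mul, norm_prod]
  refine mul_le_of_le_one_right (norm_nonneg _) (Finset.prod_le_one (fun _ _ => norm_nonneg _)
    fun i _ => ?_)
  rw [norm_pow]
  exact pow_le_one₀ (norm_nonneg _) ((norm_le_pi_norm z i).trans hz)

lemma eval_smul_of_isHomogeneous {d : ℕ} {U : MvPolynomial (Fin 2) K} (hU : U.IsHomogeneous d)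
    (c : K) (z : Fin 2 → K) :
    MvPolynomial.eval (c • z) U = c ^ d * MvPolynomial.eval z U := by
  rw [MvPolynomial.eval_eq, MvPolynomial.eval_eq, Finset.mul_sum]
  refine Finset.sum_congr rfl fun s hs => ?_
  have h : ∑ i ∈ s.support, s i = d := hU.degree_eq_sum_deg_support hs |>.symm
  simp only [Pi.smul_apply, smul_eq_mul, mul_pow, Finset.prod_mul_distrib, Finset.prod_pow_eq_pow_sum]
  rw [h]; ring

lemma lift_smul {d : ℕ} {U V : MvPolynomial (Fin 2) K} (hU : U.IsHomogeneous d)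
    (hV : V.IsHomogeneous d) (c : K) (z : Fin 2 → K) :
    lift U V (c • z) = c ^ d • lift U V z := by
  ext i
  fin_cases i <;>
    simp [lift, eval_smul_of_isHomogeneous hU, eval_smul_of_isHomogeneous hV]

lemma mem_filledJulia_iff {U V : MvPolynomial (Fin 2) K} {z : Fin 2 → K} :
    z ∈ filledJulia U V ↔ ∃ C, ∀ n, ‖(lift U V)^[n] z‖ ≤ C := by
  simp only [filledJulia, Set.mem_ofPred_eq, isBounded_iff_forall_norm_le, Set.forall_mem_range]

lemma lift_mem_filledJulia {U V : MvPolynomial (Fin 2) K} {z : Fin 2 → K} :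
    lift U V z ∈ filledJulia U V ↔ z ∈ filledJulia U V := by
  simp only [mem_filledJulia_iff, ← Function.iterate_succ_apply]
  refine ⟨fun ⟨C, hC⟩ => ⟨max C ‖z‖, fun n => ?_⟩, fun ⟨C, hC⟩ => ⟨C, fun n => hC _⟩⟩
  cases n with
  | zero => exact le_max_right _ _
  | succ n => exact (hC n).trans (le_max_left _ _)

lemma exists_eq_smul_unit {z : Fin 2 → K} (hz : z ≠ 0) :
    ∃ (c : K) (y : Fin 2 → K), ‖c‖ = ‖z‖ ∧ ‖y‖ = 1 ∧ z = c • y := by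
  obtain ⟨i, hi⟩ := exists_norm_apply_eq z
  have h0 : ‖z‖ ≠ 0 := norm_ne_zero_iff.2 hz
  have hi0 : z i ≠ 0 := norm_ne_zero_iff.1 (hi.trans_ne h0)
  refine ⟨z i, (z i)⁻¹ • z, hi, ?_, by rw [smul_inv_smul₀ hi0]⟩
  rw [norm_smul, norm_inv, hi, inv_mul_cancel₀ h0]

lemma norm_lift_le_iff {U V : MvPolynomial (Fin 2) K} {z : Fin 2 → K} {C : ℝ} (hC : 0 ≤ C) :
    ‖lift U V z‖ ≤ C ↔ ‖MvPolynomial.eval z U‖ ≤ C ∧ ‖MvPolynomial.eval z V‖ ≤ C := by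
  rw [pi_norm_le_iff_of_nonneg hC, Fin.forall_fin_two]; rfl

lemma exists_norm_lift_le {d : ℕ} {U V : MvPolynomial (Fin 2) K} (hU : U.IsHomogeneous d)
    (hV : V.IsHomogeneous d) (hd : d ≠ 0) :
    ∃ C : ℝ, 1 ≤ C ∧ ∀ z, ‖lift U V z‖ ≤ C * ‖z‖ ^ d := by
  obtain ⟨A, hA1, hA⟩ := exists_norm_eval_le U
  obtain ⟨B, hB1, hB⟩ := exists_norm_eval_le V
  refine ⟨max A B, hA1.trans (le_max_left _ _), fun z => ?_⟩
  by_cases hz : z = 0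
  · subst hz
    have : lift U V 0 = 0 := by simpa [hd] using lift_smul hU hV 0 0
    simp [this, hd]
  obtain ⟨c, y, hc, hy, rfl⟩ := exists_eq_smul_unit hz
  rw [lift_smul hU hV, norm_smul, norm_pow, ← hc, mul_comm]
  gcongr
  rw [norm_lift_le_iff (by positivity)]
  exact ⟨(hA y hy.le).trans (le_max_left _ _), (hB y hy.le).trans (le_max_right _ _)⟩

variable [IsAlgClosed K]

/-- The Nullstellensatz stands in for compactness of the unit sphere, which fails over `ℂ_p`: at a
unit vector whose coordinate `i` has norm one, the identity keeps `U` and `V` from being small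
together. -/
lemma exists_pow_mem_span {U V : MvPolynomial (Fin 2) K}
    (h0 : ∀ z : Fin 2 → K, MvPolynomial.eval z U = 0 → MvPolynomial.eval z V = 0 → z = 0)
    (i : Fin 2) : ∃ (N : ℕ) (A B : MvPolynomial (Fin 2) K), MvPolynomial.X i ^ N = A * U + B * V := by
  have h : MvPolynomial.X i ∈ (Ideal.span {U, V}).radical := by
    rw [← MvPolynomial.vanishingIdeal_zeroLocus_eq_radical (K := K)]
    intro z hz
    rw [MvPolynomial.zeroLocus_span] at hz
    have := h0 z (by simpa [MvPolynomial.aeval_eq_eval] using hz U (by simp))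
      (by simpa [MvPolynomial.aeval_eq_eval] using hz V (by simp))
    simp [this]
  obtain ⟨N, hN⟩ := h
  obtain ⟨A, B, hAB⟩ := Ideal.mem_span_pair.1 hN
  exact ⟨N, A, B, hAB.symm⟩

lemma exists_le_norm_lift {d : ℕ} {U V : MvPolynomial (Fin 2) K} (hU : U.IsHomogeneous d)
    (hV : V.IsHomogeneous d) (hd : d ≠ 0)
    (h0 : ∀ z : Fin 2 → K, MvPolynomial.eval z U = 0 → MvPolynomial.eval z V = 0 → z = 0) :
    ∃ c : ℝ, 0 < c ∧ ∀ z, c * ‖z‖ ^ d ≤ ‖lift U V z‖ := by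
  have h : ∀ i : Fin 2, ∃ C : ℝ, 1 ≤ C ∧ ∀ y : Fin 2 → K, ‖y‖ = 1 → ‖y i‖ = 1 →
      1 ≤ C * ‖lift U V y‖ := by
    intro i
    obtain ⟨N, A, B, hAB⟩ := exists_pow_mem_span h0 i
    obtain ⟨a, ha1, ha⟩ := exists_norm_eval_le A
    obtain ⟨b, hb1, hb⟩ := exists_norm_eval_le B
    refine ⟨a + b, by linarith, fun y hy hyi => ?_⟩
    have h1 := congrArg (fun P => ‖MvPolynomial.eval y P‖) hAB
    simp only [map_pow, MvPolynomial.eval_X, norm_pow, hyi, one_pow, map_add, map_mul] at h1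
    have h2 := (norm_lift_le_iff (norm_nonneg _)).1 (le_refl ‖lift U V y‖)
    rw [h1, add_mul]
    refine (norm_add_le _ _).trans (add_le_add ?_ ?_)
    · rw [norm_mul]; exact mul_le_mul (ha y hy.le) h2.1 (norm_nonneg _) (by linarith)
    · rw [norm_mul]; exact mul_le_mul (hb y hy.le) h2.2 (norm_nonneg _) (by linarith)
  choose C hC1 hC using h
  have hm : 0 < max (C 0) (C 1) := zero_lt_one.trans_le ((hC1 0).trans (le_max_left _ _))
  refine ⟨(max (C 0) (C 1))⁻¹, by positivity, fun z => ?_⟩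
  by_cases hz : z = 0
  · simp [hz, hd]
  obtain ⟨c, y, hc, hy, rfl⟩ := exists_eq_smul_unit hz
  rw [lift_smul hU hV, norm_smul (c ^ d), norm_pow, ← hc, mul_comm]
  gcongr
  obtain ⟨i, hi⟩ := exists_norm_apply_eq y
  rw [inv_le_iff_one_le_mul₀' hm]
  refine (hC i y hy (hi.trans hy)).trans (mul_le_mul_of_nonneg_right ?_ (norm_nonneg _))
  fin_cases i
  exacts [le_max_left _ _, le_max_right _ _]

lemma isBounded_filledJulia {d : ℕ} {U V : MvPolynomial (Fin 2) K} (hU : U.IsHomogeneous d)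
    (hV : V.IsHomogeneous d) (hd : 2 ≤ d)
    (h0 : ∀ z : Fin 2 → K, MvPolynomial.eval z U = 0 → MvPolynomial.eval z V = 0 → z = 0) :
    Bornology.IsBounded (filledJulia U V) := by
  obtain ⟨c, hc, h⟩ := exists_le_norm_lift hU hV (by omega) h0
  -- Outside this radius every application of the lift at least doubles the norm, as `d ≥ 2`.
  refine isBounded_iff_forall_norm_le.2 ⟨max 1 (2 / c), fun z hz => ?_⟩
  by_contra! hlt
  have h1 : 1 < ‖z‖ := (le_max_left _ _).trans_lt hlt
  have h2 : 2 < c * ‖z‖ := by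
    rw [mul_comm, ← div_lt_iff₀ hc]; exact (le_max_right _ _).trans_lt hlt
  have key : ∀ n : ℕ, 2 ^ n * ‖z‖ ≤ ‖(lift U V)^[n] z‖ := by
    intro n
    induction n with
    | zero => simp
    | succ n ih =>
      rw [Function.iterate_succ_apply']
      set y := (lift U V)^[n] z
      have hy : ‖z‖ ≤ ‖y‖ := (le_mul_of_one_le_left (by positivity) (one_le_pow₀ one_le_two)).trans ih
      calc 2 ^ (n + 1) * ‖z‖ = 2 * (2 ^ n * ‖z‖) := by ring
        _ ≤ (c * ‖z‖) * ‖y‖ := by gcongr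
        _ ≤ (c * ‖y‖) * ‖y‖ := by gcongr
        _ = c * ‖y‖ ^ 2 := by ring
        _ ≤ c * ‖y‖ ^ d := by gcongr; linarith
        _ ≤ _ := h y
  obtain ⟨C, hC⟩ := mem_filledJulia_iff.1 hz
  obtain ⟨n, hn⟩ := pow_unbounded_of_one_lt C one_lt_two
  have h3 := hC n
  have h4 := key n
  have : (2 : ℝ) ^ n ≤ 2 ^ n * ‖z‖ := le_mul_of_one_le_right (by positivity) h1.le
  linarith

omit [IsAlgClosed K] in
lemma exists_ball_subset_filledJulia {d : ℕ} {U V : MvPolynomial (Fin 2) K}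
    (hU : U.IsHomogeneous d) (hV : V.IsHomogeneous d) (hd : 2 ≤ d) :
    ∃ r : ℝ, 0 < r ∧ ∀ z, ‖z‖ ≤ r → z ∈ filledJulia U V := by
  obtain ⟨C, hC1, h⟩ := exists_norm_lift_le hU hV (by omega)
  have hC : 0 < C := by linarith
  refine ⟨C⁻¹, by positivity, fun z hz => mem_filledJulia_iff.2 ⟨C⁻¹, fun n => ?_⟩⟩
  induction n with
  | zero => simpa
  | succ n ih =>
    rw [Function.iterate_succ_apply']
    set y := (lift U V)^[n] z
    calc _ ≤ C * ‖y‖ ^ d := h y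
      _ ≤ C * ‖y‖ ^ 2 := by
        exact mul_le_mul_of_nonneg_left (pow_le_pow_of_le_one (norm_nonneg _)
          (ih.trans (inv_le_one_of_one_le₀ hC1)) hd) hC.le
      _ ≤ C * C⁻¹ ^ 2 := by gcongr
      _ = C⁻¹ := by field_simp

end Julia

/-! ### Fibres of the lift, the resultant and the Wronskian -/

section Preimages

lemma dehomogenize_eq_sum (P : MvPolynomial (Fin 2) K) :
    dehomogenize P = ∑ s ∈ P.support, Polynomial.C (P.coeff s) * Polynomial.X ^ s 0 := by
  rw [dehomogenize, MvPolynomial.aeval_def, MvPolynomial.eval₂_eq']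
  simp [Fin.prod_univ_two]

lemma apply_zero_add_apply_one {d : ℕ} {P : MvPolynomial (Fin 2) K} (hP : P.IsHomogeneous d)
    {s : Fin 2 →₀ ℕ} (hs : s ∈ P.support) : s 0 + s 1 = d := by
  have h := hP (MvPolynomial.mem_support_iff.1 hs)
  rw [← h, Finsupp.weight_apply, Finsupp.sum_fintype _ _ (by simp)]
  simp [Fin.sum_univ_two]

lemma natDegree_dehomogenize_le {d : ℕ} {P : MvPolynomial (Fin 2) K} (hP : P.IsHomogeneous d) :
    (dehomogenize P).natDegree ≤ d := by
  rw [dehomogenize_eq_sum]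
  refine Polynomial.natDegree_sum_le_of_forall_le _ _ fun s hs => ?_
  have := apply_zero_add_apply_one hP hs
  exact (Polynomial.natDegree_C_mul_X_pow_le _ _).trans (by omega)

lemma eval_eq_sum_dehomogenize {d : ℕ} {P : MvPolynomial (Fin 2) K} (hP : P.IsHomogeneous d)
    (z : Fin 2 → K) :
    MvPolynomial.eval z P =
      ∑ j ∈ Finset.range (d + 1), (dehomogenize P).coeff j * (z 0 ^ j * z 1 ^ (d - j)) := by
  simp only [dehomogenize_eq_sum, Polynomial.finsetSum_coeff, Polynomial.coeff_C_mul_X_pow,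
    Finset.sum_mul]
  rw [Finset.sum_comm, MvPolynomial.eval_eq']
  refine Finset.sum_congr rfl fun s hs => ?_
  have h := apply_zero_add_apply_one hP hs
  rw [Finset.sum_eq_single (s 0)]
  · simp [Fin.prod_univ_two, ← h]
  · intro j _ hj; simp [hj]
  · intro h'; exact absurd (Finset.mem_range.2 (by omega)) h'

lemma eval_one_zero {d : ℕ} {P : MvPolynomial (Fin 2) K} (hP : P.IsHomogeneous d) :
    MvPolynomial.eval ![1, 0] P = (dehomogenize P).coeff d := by
  rw [eval_eq_sum_dehomogenize hP, Finset.sum_range_succ, Finset.sum_eq_zero]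
  · simp
  · intro j hj
    have := Finset.mem_range.1 hj
    simp [zero_pow (show d - j ≠ 0 by omega)]

lemma eval_dehomogenize (P : MvPolynomial (Fin 2) K) (t : K) :
    (dehomogenize P).eval t = MvPolynomial.eval ![t, 1] P := by
  rw [dehomogenize_eq_sum, MvPolynomial.eval_eq', Polynomial.eval_finsetSum]
  simp [Fin.prod_univ_two]

lemma exists_roots_eq_map [IsAlgClosed K] {q : Polynomial K} {d : ℕ} (hq : q.natDegree = d) :
    ∃ t : Fin d → K, q.roots = Finset.univ.val.map t := by
  obtain ⟨l, hl⟩ := Quot.exists_rep q.roots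
  have hd : l.length = d := by
    rw [← hq, (IsAlgClosed.splits q).natDegree_eq_card_roots, ← hl]; rfl
  subst hd
  refine ⟨l.get, ?_⟩
  rw [Fin.univ_val_map, List.ofFn_get, ← hl]; rfl

lemma eq_C_mul_prod_of_roots [IsAlgClosed K] {q : Polynomial K} {d : ℕ} {t : Fin d → K}
    (ht : q.roots = Finset.univ.val.map t) :
    q = Polynomial.C q.leadingCoeff * ∏ l, (Polynomial.X - Polynomial.C (t l)) := by
  conv_lhs => rw [(IsAlgClosed.splits q).eq_prod_roots, ht, Multiset.map_map]
  rfl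

lemma eval_derivative_of_eq_prod {q : Polynomial K} {d : ℕ} {t : Fin d → K} {a : K}
    (hq : q = Polynomial.C a * ∏ l, (Polynomial.X - Polynomial.C (t l))) (l : Fin d) :
    q.derivative.eval (t l) = a * ∏ j ∈ Finset.univ.erase l, (t l - t j) := by
  rw [hq, Polynomial.derivative_C_mul, Polynomial.derivative_prod_finset, Polynomial.eval_C_mul,
    Polynomial.eval_finsetSum, Finset.sum_eq_single l]
  · simp [Polynomial.eval_prod]
  · intro j _ hj
    rw [Polynomial.eval_mul, Polynomial.eval_prod,
      Finset.prod_eq_zero (Finset.mem_erase.2 ⟨hj.symm, Finset.mem_univ l⟩) (by simp), zero_mul]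
  · simp

/-- The polynomial whose roots are the affine preimages of the direction `w`. -/
def fiberPoly (U V : MvPolynomial (Fin 2) K) (w : Fin 2 → K) : Polynomial K :=
  Polynomial.C (w 0) * dehomogenize V - Polynomial.C (w 1) * dehomogenize U

lemma eval_fiberPoly (U V : MvPolynomial (Fin 2) K) (w : Fin 2 → K) (t : K) :
    (fiberPoly U V w).eval t = wedge w (lift U V ![t, 1]) := by
  simp [fiberPoly, wedge, lift, eval_dehomogenize]; ring

section

variable {d : ℕ} {U V : MvPolynomial (Fin 2) K}

lemma coeff_fiberPoly (hU : U.IsHomogeneous d) (hV : V.IsHomogeneous d) (w : Fin 2 → K) :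
    (fiberPoly U V w).coeff d = wedge w (lift U V ![1, 0]) := by
  simp [fiberPoly, wedge, lift, eval_one_zero hU, eval_one_zero hV]; ring

lemma natDegree_fiberPoly (hU : U.IsHomogeneous d) (hV : V.IsHomogeneous d) {w : Fin 2 → K}
    (hw : wedge w (lift U V ![1, 0]) ≠ 0) : (fiberPoly U V w).natDegree = d := by
  refine le_antisymm ?_ (Polynomial.le_natDegree_of_ne_zero (by rwa [coeff_fiberPoly hU hV]))
  refine (Polynomial.natDegree_sub_le _ _).trans (max_le ?_ ?_)
  · exact (Polynomial.natDegree_C_mul_le _ _).trans (natDegree_dehomogenize_le hV)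
  · exact (Polynomial.natDegree_C_mul_le _ _).trans (natDegree_dehomogenize_le hU)

lemma wedge_smul_right (w x : Fin 2 → K) (c : K) : wedge w (c • x) = c * wedge w x := by
  simp [wedge]; ring

lemma wedge_smul_left (w x : Fin 2 → K) (c : K) : wedge (c • w) x = c * wedge w x := by
  simp [wedge]; ring

lemma fiberPoly_eq_prod [IsAlgClosed K] (hU : U.IsHomogeneous d) (hV : V.IsHomogeneous d)
    {w : Fin 2 → K} (hw : wedge w (lift U V ![1, 0]) ≠ 0) {t : Fin d → K}
    (ht : (fiberPoly U V w).roots = Finset.univ.val.map t) :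
    fiberPoly U V w = Polynomial.C (wedge w (lift U V ![1, 0])) *
      ∏ l, (Polynomial.X - Polynomial.C (t l)) := by
  conv_lhs => rw [eq_C_mul_prod_of_roots ht, Polynomial.leadingCoeff, natDegree_fiberPoly hU hV hw,
    coeff_fiberPoly hU hV]

/-- As a form in `x`, the left side dehomogenizes to `fiberPoly U V w`; the line `x 1 = 0` is
checked separately. -/
lemma wedge_lift_eq_prod (hU : U.IsHomogeneous d) (hV : V.IsHomogeneous d) {w : Fin 2 → K}
    {t : Fin d → K} (ht : fiberPoly U V w = Polynomial.C (wedge w (lift U V ![1, 0])) *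
      ∏ l, (Polynomial.X - Polynomial.C (t l))) (x : Fin 2 → K) :
    wedge w (lift U V x) = wedge w (lift U V ![1, 0]) * ∏ l, (x 0 - t l * x 1) := by
  by_cases hx : x 1 = 0
  · have h : x = x 0 • ![1, 0] := by ext i; fin_cases i <;> simp [hx]
    conv_lhs => rw [h, lift_smul hU hV, wedge_smul_right]
    simp [hx, mul_comm]
  · have h : x = x 1 • ![x 0 / x 1, 1] := by
      ext i; fin_cases i <;> simp [mul_div_cancel₀, hx]
    conv_lhs => rw [h, lift_smul hU hV, wedge_smul_right, ← eval_fiberPoly, ht]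
    simp only [Polynomial.eval_mul, Polynomial.eval_C, Polynomial.eval_prod, Polynomial.eval_sub,
      Polynomial.eval_X]
    rw [mul_left_comm]
    congr 1
    rw [show x 1 ^ d = ∏ _l : Fin d, x 1 by simp, ← Finset.prod_mul_distrib]
    refine Finset.prod_congr rfl fun l _ => ?_
    field_simp

/-- With `u`, `v` the dehomogenizations, compute `Res(w₀ v - w₁ u, u)` twice: as a product over the
roots of the first argument, and, after removing the multiple of `u`, as `w₀^d Res(v, u)`. -/
lemma norm_prod_eval_roots [IsAlgClosed K] (hU : U.IsHomogeneous d) (hV : V.IsHomogeneous d)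
    {w : Fin 2 → K} (hw : wedge w (lift U V ![1, 0]) ≠ 0)
    {t : Fin d → K} (ht : (fiberPoly U V w).roots = Finset.univ.val.map t) :
    ‖wedge w (lift U V ![1, 0])‖ ^ d * ∏ l, ‖(dehomogenize U).eval (t l)‖ =
      ‖w 0‖ ^ d * ‖formResultant d U V‖ := by
  have h1 := Polynomial.resultant_eq_prod_eval (fiberPoly U V w) (dehomogenize U) d
    (natDegree_dehomogenize_le hU) (IsAlgClosed.splits _)
  rw [Polynomial.leadingCoeff, natDegree_fiberPoly hU hV hw, coeff_fiberPoly hU hV, ht,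
    Multiset.map_map] at h1
  have h2 : fiberPoly U V w = Polynomial.C (w 0) * dehomogenize V +
      dehomogenize U * Polynomial.C (-w 1) := by
    rw [fiberPoly, Polynomial.C_neg]; ring
  rw [h2, Polynomial.resultant_add_mul_left _ _ _ _ _ (by simp) (natDegree_dehomogenize_le hU),
    Polynomial.resultant_C_mul_left, Polynomial.resultant_comm] at h1
  have h3 := congrArg norm h1
  rw [norm_mul, norm_mul, norm_mul, norm_pow, norm_pow, norm_pow, norm_neg, norm_one, one_pow,
    one_mul] at h3
  rw [formResultant, h3, ← norm_prod]
  rfl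

lemma eval_root_ne_zero (h0 : ∀ z : Fin 2 → K, MvPolynomial.eval z U = 0 →
      MvPolynomial.eval z V = 0 → z = 0) {w : Fin 2 → K} (hw0 : w 0 ≠ 0) {t : K}
    (ht : (fiberPoly U V w).eval t = 0) : (dehomogenize U).eval t ≠ 0 := by
  intro hu
  have hv : (dehomogenize V).eval t = 0 := by simpa [fiberPoly, hu, hw0] using ht
  have := congrFun (h0 ![t, 1] (by rwa [← eval_dehomogenize]) (by rwa [← eval_dehomogenize])) 1
  simp at this

lemma eval_root_eq_zero {q : Polynomial K} {t : Fin d → K}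
    (ht : q.roots = Finset.univ.val.map t) (l : Fin d) : q.eval (t l) = 0 := by
  have : t l ∈ q.roots := by rw [ht]; exact Multiset.mem_map_of_mem t (Finset.mem_univ_val l)
  exact Polynomial.isRoot_of_mem_roots this

lemma lift_ne_zero (h0 : ∀ z : Fin 2 → K, MvPolynomial.eval z U = 0 →
      MvPolynomial.eval z V = 0 → z = 0) {x : Fin 2 → K} (hx : x ≠ 0) : lift U V x ≠ 0 := by
  intro h
  exact hx (h0 _ (congrFun h 0) (congrFun h 1))

lemma formResultant_ne_zero [IsAlgClosed K] (hU : U.IsHomogeneous d) (hV : V.IsHomogeneous d)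
    (h0 : ∀ z : Fin 2 → K, MvPolynomial.eval z U = 0 → MvPolynomial.eval z V = 0 → z = 0) :
    formResultant d U V ≠ 0 := by
  obtain ⟨w, hw0, hw⟩ : ∃ w : Fin 2 → K, w 0 ≠ 0 ∧ wedge w (lift U V ![1, 0]) ≠ 0 := by
    by_cases h : lift U V ![1, 0] 1 = 0
    · refine ⟨![1, 1], by simp, fun h' => ?_⟩
      refine lift_ne_zero h0 (x := ![1, 0]) (fun h => by simpa using congrFun h 0) ?_
      ext i
      fin_cases i
      · simpa [wedge, h] using h'
      · exact h
    · exact ⟨![1, 0], by simp, by simpa [wedge] using h⟩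
  obtain ⟨t, ht⟩ := exists_roots_eq_map (natDegree_fiberPoly hU hV hw)
  have h1 := norm_prod_eval_roots hU hV hw ht
  intro hR
  rw [hR, norm_zero, mul_zero, mul_eq_zero, Finset.prod_eq_zero_iff] at h1
  rcases h1 with h1 | ⟨l, -, h1⟩
  · exact hw (norm_eq_zero.1 (eq_zero_of_pow_eq_zero h1))
  · exact eval_root_ne_zero h0 hw0 (eval_root_eq_zero ht l) (norm_eq_zero.1 h1)

/-- A point `w` in general position has `d` preimages under the lift, one on each line. -/
lemma exists_fiber [IsAlgClosed K] (hU : U.IsHomogeneous d) (hV : V.IsHomogeneous d) (hd : d ≠ 0)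
    (h0 : ∀ z : Fin 2 → K, MvPolynomial.eval z U = 0 → MvPolynomial.eval z V = 0 → z = 0)
    {w : Fin 2 → K} (hw0 : w 0 ≠ 0) (hw : wedge w (lift U V ![1, 0]) ≠ 0)
    {ρ : ℝ} (hρ0 : 0 ≤ ρ) (hρ : ρ ^ d * ‖formResultant d U V‖ = 1) :
    ∃ t c : Fin d → K, (fiberPoly U V w).roots = Finset.univ.val.map t ∧
      (∀ l, c l ^ d * (dehomogenize U).eval (t l) = w 0) ∧
      (∀ l, lift U V (c l • ![t l, 1]) = w) ∧
      ∏ l, ‖c l‖ = ρ * ‖wedge w (lift U V ![1, 0])‖ := by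
  obtain ⟨t, ht⟩ := exists_roots_eq_map (natDegree_fiberPoly hU hV hw)
  have hu := fun l => eval_root_ne_zero h0 hw0 (eval_root_eq_zero ht l)
  choose c hc using fun l => IsAlgClosed.exists_pow_nat_eq (w 0 / (dehomogenize U).eval (t l))
    (Nat.pos_of_ne_zero hd)
  have hcu : ∀ l, c l ^ d * (dehomogenize U).eval (t l) = w 0 := fun l => by
    rw [hc, div_mul_cancel₀ _ (hu l)]
  refine ⟨t, c, ht, hcu, fun l => ?_, ?_⟩
  · have hv : w 0 * (dehomogenize V).eval (t l) = w 1 * (dehomogenize U).eval (t l) := by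
      have := eval_root_eq_zero ht l
      simpa [fiberPoly, sub_eq_zero] using this
    rw [lift_smul hU hV]
    ext i
    fin_cases i
    · simpa [lift, ← eval_dehomogenize] using hcu l
    · have : c l ^ d * (dehomogenize V).eval (t l) = w 1 := by
        rw [hc, div_mul_eq_mul_div, hv, mul_div_cancel_right₀ _ (hu l)]
      simpa [lift, ← eval_dehomogenize] using this
  -- Compare `d`-th powers: multiplying `c l ^ d * u(t l) = w 0` over `l` and inserting the
  -- resultant identity cancels the values of `u`.
  · refine (pow_left_inj₀ (Finset.prod_nonneg fun _ _ => norm_nonneg _) (by positivity) hd).1 ?_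
    have h1 := norm_prod_eval_roots hU hV hw ht
    have h2 : (∏ l, ‖c l‖) ^ d * ∏ l, ‖(dehomogenize U).eval (t l)‖ = ‖w 0‖ ^ d := by
      rw [← Finset.prod_pow, ← Finset.prod_mul_distrib]
      simp [← norm_pow, ← norm_mul, hcu]
    have h3 : ∏ l, ‖(dehomogenize U).eval (t l)‖ ≠ 0 :=
      Finset.prod_ne_zero_iff.2 fun l _ => norm_ne_zero_iff.2 (hu l)
    refine mul_right_cancel₀ h3 ?_
    rw [h2, mul_pow, mul_assoc, h1]
    linear_combination -(‖w 0‖ ^ d) * hρ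

/-- The product of the scalars `c l` supplies exactly `ρ` times the leading coefficient in the
factorization of `w ∧ F(x)`. -/
lemma prod_wedgeDist_fiber [IsAlgClosed K] (hU : U.IsHomogeneous d) (hV : V.IsHomogeneous d)
    {w : Fin 2 → K} (hw : wedge w (lift U V ![1, 0]) ≠ 0) {ρ : ℝ} {t c : Fin d → K}
    (ht : (fiberPoly U V w).roots = Finset.univ.val.map t)
    (hc : ∏ l, ‖c l‖ = ρ * ‖wedge w (lift U V ![1, 0])‖) (x : Fin 2 → K) :
    ∏ l, wedgeDist (c l • ![t l, 1]) x = ρ * wedgeDist w (lift U V x) := by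
  simp only [wedgeDist_eq, wedge_smul_left, norm_mul, Finset.prod_mul_distrib, hc]
  rw [wedge_lift_eq_prod hU hV (fiberPoly_eq_prod hU hV hw ht) x, norm_mul, norm_prod, mul_assoc]
  congr 2
  refine Finset.prod_congr rfl fun l _ => ?_
  rw [norm_sub_rev]
  simp [wedge, mul_comm]

/-- For coprime polynomials a zero Wronskian kills both derivatives. In characteristic zero both are
then constant, so, as `d ≠ 0`, the lift would vanish at `(1, 0)`. -/
lemma wronskian_dehomogenize_ne_zero [IsAlgClosed K] [CharZero K] (hU : U.IsHomogeneous d)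
    (hV : V.IsHomogeneous d) (hd : d ≠ 0)
    (h0 : ∀ z : Fin 2 → K, MvPolynomial.eval z U = 0 → MvPolynomial.eval z V = 0 → z = 0) :
    Polynomial.wronskian (dehomogenize U) (dehomogenize V) ≠ 0 := by
  have hcop : IsCoprime (dehomogenize U) (dehomogenize V) := by
    rw [Polynomial.isCoprime_iff_aeval_ne_zero_of_isAlgClosed K K]
    intro t
    simp only [Polynomial.coe_aeval_eq_eval, eval_dehomogenize]
    by_contra! h
    have := congrFun (h0 _ h.1 h.2) 1
    simp at this
  intro h
  obtain ⟨hu, hv⟩ := hcop.wronskian_eq_zero_iff.1 h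
  have hz : ∀ {P : MvPolynomial (Fin 2) K}, P.IsHomogeneous d →
      Polynomial.derivative (dehomogenize P) = 0 → MvPolynomial.eval ![1, 0] P = 0 := by
    intro P hP h
    rw [eval_one_zero hP, Polynomial.coeff_eq_zero_of_natDegree_lt]
    rw [Polynomial.derivative_eq_zero.1 h]
    omega
  have := congrFun (h0 _ (hz hU hu) (hz hV hv)) 0
  simp at this

/-- At a root of `q = w₀ v - w₁ u` one has `u q' = w₀ W`, so `q'(t l) = c l ^ d * W(t l)`, while
`q'(t l)` is the leading coefficient times `∏ (t l - t j)`. The scalars contribute `2 (d - 1)`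
powers of their product directly and `d` more through `q'`. -/
lemma pairProd_fiber [IsAlgClosed K] (hU : U.IsHomogeneous d) (hV : V.IsHomogeneous d)
    {w : Fin 2 → K} (hw : wedge w (lift U V ![1, 0]) ≠ 0) {ρ : ℝ} {t c : Fin d → K}
    (ht : (fiberPoly U V w).roots = Finset.univ.val.map t)
    (hcu : ∀ l, c l ^ d * (dehomogenize U).eval (t l) = w 0)
    (hu : ∀ l, (dehomogenize U).eval (t l) ≠ 0)
    (hc : ∏ l, ‖c l‖ = ρ * ‖wedge w (lift U V ![1, 0])‖) :
    pairProd (fun l => c l • ![t l, 1]) * ‖wedge w (lift U V ![1, 0])‖ ^ d =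
      (ρ * ‖wedge w (lift U V ![1, 0])‖) ^ (3 * d - 2) *
        ∏ l, ‖(Polynomial.wronskian (dehomogenize U) (dehomogenize V)).eval (t l)‖ := by
  set a := wedge w (lift U V ![1, 0]) with ha
  set W := Polynomial.wronskian (dehomogenize U) (dehomogenize V) with hW
  have hq := fiberPoly_eq_prod hU hV hw ht
  have h1 : ∀ l, c l ^ d * W.eval (t l) = a * ∏ j ∈ Finset.univ.erase l, (t l - t j) := by
    intro l
    rw [← eval_derivative_of_eq_prod hq l]
    have h2 := eval_root_eq_zero ht l
    refine mul_left_cancel₀ (hu l) ?_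
    simp only [fiberPoly, Polynomial.eval_sub, Polynomial.eval_mul, Polynomial.eval_C,
      Polynomial.derivative_sub, Polynomial.derivative_C_mul, hW, Polynomial.wronskian] at h2 ⊢
    linear_combination ((dehomogenize U).eval (t l) * (dehomogenize V).derivative.eval (t l) -
      (dehomogenize U).derivative.eval (t l) * (dehomogenize V).eval (t l)) * hcu l -
      (dehomogenize U).derivative.eval (t l) * h2
  have h3 : pairProd (fun l => c l • ![t l, 1]) =
      (∏ l, ‖c l‖) ^ (d - 1) * (∏ l, ‖c l‖) ^ (d - 1) *
        ∏ l, ‖∏ j ∈ Finset.univ.erase l, (t l - t j)‖ := by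
    have h4 : ∏ l, ∏ j ∈ Finset.univ.erase l, ‖c j‖ = (∏ l, ‖c l‖) ^ (d - 1) := by
      rw [Finset.prod_comm' (t' := Finset.univ) (s' := fun j => Finset.univ.erase j)
        (by simp [eq_comm]), ← Finset.prod_pow]
      exact Finset.prod_congr rfl fun l _ => by simp
    have h5 : ∏ l, ∏ j ∈ Finset.univ.erase l, ‖c l‖ = (∏ l, ‖c l‖) ^ (d - 1) := by
      rw [← Finset.prod_pow]
      exact Finset.prod_congr rfl fun l _ => by simp
    rw [pairProd, prod_offDiag_eq (fun i j => wedgeDist (c i • ![t i, 1]) (c j • ![t j, 1]))]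
    conv_rhs => rw [← h4]
    rw [h4, ← h5]
    nth_rewrite 2 [h5]
    rw [← h4, ← Finset.prod_mul_distrib, ← Finset.prod_mul_distrib]
    refine Finset.prod_congr rfl fun l _ => ?_
    rw [norm_prod, ← Finset.prod_mul_distrib, ← Finset.prod_mul_distrib]
    refine Finset.prod_congr rfl fun j _ => ?_
    rw [wedgeDist_eq, wedge_smul_left, wedge_smul_right, norm_mul, norm_mul]
    simp [wedge]; ring
  have h6 : (∏ l, ‖∏ j ∈ Finset.univ.erase l, (t l - t j)‖) * ‖a‖ ^ d =
      (∏ l, ‖c l‖) ^ d * ∏ l, ‖W.eval (t l)‖ := by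
    have : ‖a‖ ^ d = ∏ _l : Fin d, ‖a‖ := by simp
    rw [this, ← Finset.prod_pow, ← Finset.prod_mul_distrib, ← Finset.prod_mul_distrib]
    refine Finset.prod_congr rfl fun l _ => ?_
    rw [mul_comm, ← norm_mul, ← h1, norm_mul, norm_pow]
  rw [h3, mul_assoc, h6, hc, ← mul_assoc, ← pow_add, ← pow_add]
  congr 2
  omega

/-- Interchange the double product of `t l - τ j`: grouped by `j`, it measures the distance from `w`
to the image of the critical point `τ j`. -/
lemma prod_norm_eval_wronskian [IsAlgClosed K] (hU : U.IsHomogeneous d) (hV : V.IsHomogeneous d)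
    {w : Fin 2 → K} (hw : wedge w (lift U V ![1, 0]) ≠ 0) {t : Fin d → K}
    (ht : (fiberPoly U V w).roots = Finset.univ.val.map t)
    {W : Polynomial K} {e : ℕ} {τ : Fin e → K} (hτ : W.roots = Finset.univ.val.map τ) :
    (∏ l, ‖W.eval (t l)‖) * ‖wedge w (lift U V ![1, 0])‖ ^ e =
      ‖W.leadingCoeff‖ ^ d * ∏ j, wedgeDist w (lift U V ![τ j, 1]) := by
  have h1 : ∀ j, wedgeDist w (lift U V ![τ j, 1]) =
      ‖wedge w (lift U V ![1, 0])‖ * ∏ l, ‖t l - τ j‖ := by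
    intro j
    rw [wedgeDist_eq, wedge_lift_eq_prod hU hV (fiberPoly_eq_prod hU hV hw ht), norm_mul, norm_prod]
    simp [norm_sub_rev]
  have h2 : ∀ l, ‖W.eval (t l)‖ = ‖W.leadingCoeff‖ * ∏ j, ‖t l - τ j‖ := by
    intro l
    conv_lhs => rw [eq_C_mul_prod_of_roots hτ]
    simp [Polynomial.eval_prod]
  simp only [h1, h2, Finset.prod_mul_distrib, Finset.prod_const, Finset.card_univ, Fintype.card_fin]
  rw [Finset.prod_comm]
  ring

/-- Fibres of the lift over a bounded set: outside the zeros of a weight, a point `w` has `d`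
projectively distinct preimages, with product of mutual distances bounded below by the weight. -/
lemma exists_weight_fiber [IsAlgClosed K] [CharZero K] (hU : U.IsHomogeneous d)
    (hV : V.IsHomogeneous d) (hd : 2 ≤ d)
    (h0 : ∀ z : Fin 2 → K, MvPolynomial.eval z U = 0 → MvPolynomial.eval z V = 0 → z = 0)
    {ρ : ℝ} (hρ0 : 0 ≤ ρ) (hρ : ρ ^ d * ‖formResultant d U V‖ = 1) (C : ℝ) :
    ∃ (L : List (Fin 2 → K)) (c : ℝ), (∀ b ∈ L, b ≠ 0) ∧ 0 < c ∧
      ∀ w : Fin 2 → K, ‖w‖ ≤ C → weight L w ≠ 0 →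
        ∃ y : Fin d → Fin 2 → K, (∀ l, lift U V (y l) = w) ∧
          (∀ x, ∏ l, wedgeDist (y l) x = ρ * wedgeDist w (lift U V x)) ∧
          c * weight L w ≤ pairProd y := by
  set W := Polynomial.wronskian (dehomogenize U) (dehomogenize V) with hW
  have hW0 : W ≠ 0 := wronskian_dehomogenize_ne_zero hU hV (by omega) h0
  obtain ⟨e, τ, hτ⟩ : ∃ (e : ℕ) (τ : Fin e → K), W.roots = Finset.univ.val.map τ :=
    ⟨_, exists_roots_eq_map rfl⟩
  set b₀ : Fin 2 → K := lift U V ![1, 0] with hb₀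
  set b : Fin e → Fin 2 → K := fun j => lift U V ![τ j, 1] with hb
  have hb₀0 : b₀ ≠ 0 := lift_ne_zero h0 fun h => by simpa using congrFun h 0
  have hbj : ∀ j, b j ≠ 0 := fun j => lift_ne_zero h0 fun h => by simpa using congrFun h 1
  have hρpos : 0 < ρ := lt_of_le_of_ne hρ0 (by
    rintro rfl; simp [show d ≠ 0 by omega] at hρ)
  have hκ : 0 < ‖W.leadingCoeff‖ := norm_pos_iff.2 (Polynomial.leadingCoeff_ne_zero.2 hW0)
  obtain ⟨B, hB1, hB⟩ : ∃ B : ℝ, 1 ≤ B ∧ ∀ w : Fin 2 → K, ‖w‖ ≤ C →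
      wedgeDist w ![0, 1] ≤ B ∧ wedgeDist w b₀ ≤ B ∧ ∀ j, wedgeDist w (b j) ≤ B := by
    have h1 : 0 ≤ 2 * |C| * ‖(![0, 1] : Fin 2 → K)‖ := by positivity
    have h1' : 0 ≤ 2 * |C| * ‖b₀‖ := by positivity
    have h2 : 0 ≤ ∑ j, 2 * |C| * ‖b j‖ := Finset.sum_nonneg fun _ _ => by positivity
    have h3 : ∀ w x : Fin 2 → K, ‖w‖ ≤ C → wedgeDist w x ≤ 2 * |C| * ‖x‖ := fun w x hw =>
      (wedgeDist_le w x).trans (by have := hw.trans (le_abs_self C); gcongr)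
    refine ⟨1 + 2 * |C| * ‖(![0, 1] : Fin 2 → K)‖ + 2 * |C| * ‖b₀‖ + ∑ j, 2 * |C| * ‖b j‖,
      by linarith, fun w hw => ⟨by linarith [h3 w ![0, 1] hw], by linarith [h3 w b₀ hw],
        fun j => ?_⟩⟩
    have := Finset.single_le_sum (f := fun j => 2 * |C| * ‖b j‖) (fun _ _ => by positivity)
      (Finset.mem_univ j)
    linarith [h3 w (b j) hw]
  -- A nonzero weight forces `w 0 ≠ 0` through `(0, 1)` and `w ∧ b₀ ≠ 0` through `b₀`, which occurs
  -- since `d ≥ 2`. The `d - 1` copies match the power `(A ^ 2) ^ (d - 1)` in `h3`; the `b j` are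
  -- critical values.
  set L : List (Fin 2 → K) := ![0, 1] :: (List.replicate (d - 1) b₀ ++ List.ofFn b) with hL
  -- The powers of `B` pay for `‖w 0‖ ^ 2`, for the second copy of each critical factor, and for `A
  -- ^ e`.
  refine ⟨L, ρ ^ (3 * d - 2) * ‖W.leadingCoeff‖ ^ d / B ^ (2 + 2 * e), ?_, by positivity, ?_⟩
  · intro x hx
    simp only [hL, List.mem_cons, List.mem_append, List.mem_replicate, List.mem_ofFn] at hx
    rcases hx with rfl | ⟨-, rfl⟩ | ⟨j, rfl⟩
    · intro h; simpa using congrFun h 1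
    · exact hb₀0
    · exact hbj j
  intro w hwC hw
  have hwL : weight L w = ‖w 0‖ ^ 2 * ((‖wedge w b₀‖ ^ 2) ^ (d - 1) *
      ∏ j, wedgeDist w (b j) ^ 2) := by
    simp [hL, weight, List.map_ofFn, List.prod_ofFn, wedgeDist_eq, wedge]
  have hw0 : w 0 ≠ 0 := by rintro h; simp [hwL, h] at hw
  have ha : wedge w b₀ ≠ 0 := by
    rintro h; simp [hwL, h, show d - 1 ≠ 0 by omega] at hw
  obtain ⟨t, c, ht, hcu, hlift, hc⟩ := exists_fiber hU hV (by omega) h0 hw0 ha hρ0 hρ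
  refine ⟨fun l => c l • ![t l, 1], hlift, prod_wedgeDist_fiber hU hV ha ht hc, ?_⟩
  have h1 := pairProd_fiber hU hV ha ht hcu
    (fun l => eval_root_ne_zero h0 hw0 (eval_root_eq_zero ht l)) hc
  have h2 := prod_norm_eval_wronskian hU hV ha ht hτ
  obtain ⟨hB2, hB3, hB4⟩ := hB w hwC
  rw [← hW] at h1
  rw [← hb₀] at h1 h2
  change _ = ‖W.leadingCoeff‖ ^ d * ∏ j, wedgeDist w (b j) at h2
  rw [wedgeDist_eq] at hB3
  have hA : 0 < ‖wedge w b₀‖ := norm_pos_iff.2 ha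
  rw [hwL]
  replace hB2 : ‖w 0‖ ≤ B := by simpa [wedgeDist] using hB2
  generalize pairProd (fun l => c l • ![t l, 1]) = P at h1 ⊢
  generalize ‖wedge w b₀‖ = A at *
  have h3 : P * A ^ e = ρ ^ (3 * d - 2) * ‖W.leadingCoeff‖ ^ d *
      ((A ^ 2) ^ (d - 1) * ∏ j, wedgeDist w (b j)) := by
    refine mul_right_cancel₀ (pow_ne_zero d hA.ne') ?_
    have h4 : (ρ * A) ^ (3 * d - 2) = ρ ^ (3 * d - 2) * ((A ^ 2) ^ (d - 1) * A ^ d) := by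
      rw [mul_pow, ← pow_mul, ← pow_add]
      congr 2
      omega
    rw [h4] at h1
    linear_combination A ^ e * h1 + ρ ^ (3 * d - 2) * ((A ^ 2) ^ (d - 1) * A ^ d) * h2
  have h5 : ∏ j, wedgeDist w (b j) ^ 2 ≤ B ^ e * ∏ j, wedgeDist w (b j) := by
    have : B ^ e = ∏ _j : Fin e, B := by simp
    rw [this, ← Finset.prod_mul_distrib]
    refine Finset.prod_le_prod (fun j _ => by positivity) fun j _ => ?_
    rw [sq]
    exact mul_le_mul_of_nonneg_right (hB4 j) (wedgeDist_nonneg _ _)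
  have hD : 0 ≤ ∏ j, wedgeDist w (b j) := Finset.prod_nonneg fun _ _ => wedgeDist_nonneg _ _
  refine le_of_mul_le_mul_right ?_ (pow_pos hA e)
  rw [h3, div_mul_eq_mul_div, div_mul_eq_mul_div, div_le_iff₀ (by positivity)]
  calc ρ ^ (3 * d - 2) * ‖W.leadingCoeff‖ ^ d * (‖w 0‖ ^ 2 * ((A ^ 2) ^ (d - 1) *
        ∏ j, wedgeDist w (b j) ^ 2)) * A ^ e
      ≤ ρ ^ (3 * d - 2) * ‖W.leadingCoeff‖ ^ d * (B ^ 2 * ((A ^ 2) ^ (d - 1) *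
        (B ^ e * ∏ j, wedgeDist w (b j)))) * B ^ e := by
        have := Finset.prod_nonneg (s := Finset.univ) (f := fun j => wedgeDist w (b j) ^ 2)
          fun j _ => by positivity
        gcongr
    _ = _ := by rw [pow_add, two_mul e, pow_add]; ring

end

end Preimages

/-! ### Pulling back tuples: the lower comparison -/

section Pullback

lemma pairProd_prod_eq {d m : ℕ} (y : Fin d × Fin m → Fin 2 → K) :
    pairProd y = (∏ k, pairProd fun l => y (l, k)) *
      ∏ p ∈ (Finset.univ : Finset (Fin m)).offDiag,
        ∏ l', ∏ l, wedgeDist (y (l, p.1)) (y (l', p.2)) := by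
  have h1 : ∀ (i : Fin d × Fin m) (g : Fin d × Fin m → ℝ), ∏ j ∈ Finset.univ.erase i, g j =
      (∏ l ∈ Finset.univ.erase i.1, g (l, i.2)) *
        ∏ k ∈ Finset.univ.erase i.2, ∏ l, g (l, k) := by
    intro i g
    have h2 : (Finset.univ.erase i : Finset (Fin d × Fin m)) =
        (Finset.univ.erase i.1 ×ˢ {i.2}) ∪ (Finset.univ ×ˢ Finset.univ.erase i.2) := by
      ext j
      simp only [Finset.mem_erase, Finset.mem_univ, and_true, Finset.mem_union, Finset.mem_product,
        Finset.mem_singleton, true_and, ne_eq, Prod.ext_iff]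
      tauto
    rw [h2, Finset.prod_union, Finset.prod_product, Finset.prod_product_right]
    · simp
    · rw [Finset.disjoint_left]
      intro j hj hj'
      simp only [Finset.mem_product, Finset.mem_erase, Finset.mem_singleton] at hj hj'
      exact hj'.2.1 hj.2
  rw [pairProd, prod_offDiag_eq (fun i j => wedgeDist (y i) (y j))]
  simp only [h1, Finset.prod_mul_distrib]
  congr 1
  · rw [Fintype.prod_prod_type, Finset.prod_comm]
    exact Finset.prod_congr rfl fun k _ =>
      (prod_offDiag_eq (fun l l' => wedgeDist (y (l, k)) (y (l', k)))).symm
  · rw [Fintype.prod_prod_type, Finset.prod_comm,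
      prod_offDiag_eq (fun k k' => ∏ l', ∏ l, wedgeDist (y (l, k)) (y (l', k')))]
    refine Finset.prod_congr rfl fun k _ => ?_
    dsimp only
    exact Finset.prod_comm.trans (Finset.prod_congr rfl fun k' _ => Finset.prod_comm)

/-- Between the fibres over `w k` and `w k'`, the product over one fibre depends only on the image
of the other point, so the `d²` distances multiply to `(ρ d(w k, w k'))^d`. -/
lemma pairProd_fibers {d m : ℕ} {F : (Fin 2 → K) → Fin 2 → K} {ρ : ℝ}
    {w : Fin m → Fin 2 → K} {y : Fin d × Fin m → Fin 2 → K} (hy : ∀ l k, F (y (l, k)) = w k)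
    (hprod : ∀ k x, ∏ l, wedgeDist (y (l, k)) x = ρ * wedgeDist (w k) (F x)) :
    pairProd y = (∏ k, pairProd fun l => y (l, k)) * ((ρ ^ d) ^ (m * m - m) * pairProd w ^ d) := by
  rw [pairProd_prod_eq]
  congr 1
  simp only [hprod, hy, Finset.prod_const, Finset.card_univ, Fintype.card_fin, mul_pow,
    Finset.prod_mul_distrib, Finset.offDiag_card, pairProd, ← Finset.prod_pow]

/-- The supremum of `pairProd` over the `n`-tuples of points of `S`. -/
def supPairProd (S : Set (Fin 2 → K)) (n : ℕ) : ℝ :=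
  sSup (pairProd '' {z : Fin n → Fin 2 → K | ∀ i, z i ∈ S})

section

variable {S : Set (Fin 2 → K)} {C : ℝ}

lemma bddAbove_pairProd (hS : ∀ z ∈ S, ‖z‖ ≤ C) (n : ℕ) :
    BddAbove (pairProd '' {z : Fin n → Fin 2 → K | ∀ i, z i ∈ S}) := by
  refine ⟨(2 * C * C) ^ (Fintype.card (Fin n) * Fintype.card (Fin n) - Fintype.card (Fin n)), ?_⟩
  rintro _ ⟨z, hz, rfl⟩
  exact pairProd_le fun i => hS _ (hz i)

lemma pairProd_le_sup (hS : ∀ z ∈ S, ‖z‖ ≤ C) {n : ℕ} {z : Fin n → Fin 2 → K}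
    (hz : ∀ i, z i ∈ S) : pairProd z ≤ supPairProd S n :=
  le_csSup (bddAbove_pairProd hS n) ⟨z, hz, rfl⟩

lemma supPairProd_nonneg (n : ℕ) : 0 ≤ supPairProd S n :=
  Real.sSup_nonneg (by rintro _ ⟨z, -, rfl⟩; exact pairProd_nonneg z)

/-- The supremum need not be attained. Being `2²`, the constant 4 becomes a bound 2 for ratios of
determinants. -/
lemma exists_pairProd_ge {n : ℕ} (h : 0 < supPairProd S n) :
    ∃ z : Fin n → Fin 2 → K, (∀ i, z i ∈ S) ∧ supPairProd S n ≤ 4 * pairProd z := by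
  have hne : (pairProd '' {z : Fin n → Fin 2 → K | ∀ i, z i ∈ S}).Nonempty := by
    by_contra h'
    rw [Set.not_nonempty_iff_eq_empty] at h'
    simp [supPairProd, h'] at h
  obtain ⟨_, ⟨z, hz, rfl⟩, h1⟩ := exists_lt_of_lt_csSup hne
    (show supPairProd S n / 4 < sSup _ from by rw [← supPairProd]; linarith)
  exact ⟨z, hz, by linarith⟩

variable {d : ℕ} {U V : MvPolynomial (Fin 2) K}

lemma exists_fiber_tuple [IsAlgClosed K] [CharZero K] (hU : U.IsHomogeneous d)
    (hV : V.IsHomogeneous d) (hd : 2 ≤ d)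
    (h0 : ∀ z : Fin 2 → K, MvPolynomial.eval z U = 0 → MvPolynomial.eval z V = 0 → z = 0)
    (hS : ∀ z ∈ S, ‖z‖ ≤ C) :
    ∃ (N : ℕ) (D : ℝ), 1 ≤ D ∧ ∀ (m : ℕ) (z : Fin (m + N) → Fin 2 → K), (∀ i, z i ∈ S) →
      0 < pairProd z → ∃ (w : Fin m → Fin 2 → K) (y : Fin d × Fin m → Fin 2 → K),
        (∀ k, w k ∈ S) ∧ (∀ l k, lift U V (y (l, k)) = w k) ∧ 0 < pairProd w ∧
        (∀ k, 0 < pairProd fun l => y (l, k)) ∧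
        pairProd y * ‖formResultant d U V‖ ^ (m * m - m) =
          (∏ k, pairProd fun l => y (l, k)) * pairProd w ^ d ∧
        pairProd z ^ d ≤ D ^ (m + 1) * ((∏ k, pairProd fun l => y (l, k)) * pairProd w ^ d) := by
  have hR : 0 < ‖formResultant d U V‖ := norm_pos_iff.2 (formResultant_ne_zero hU hV h0)
  set R := ‖formResultant d U V‖ with hRdef
  obtain ⟨ρ, hρ0, hρ⟩ : ∃ ρ : ℝ, 0 ≤ ρ ∧ ρ ^ d * R = 1 := by
    refine ⟨R⁻¹ ^ (1 / (d : ℝ)), by positivity, ?_⟩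
    rw [one_div, Real.rpow_inv_natCast_pow (by positivity) (by omega), inv_mul_cancel₀ hR.ne']
  obtain ⟨L, c, hL, hc, hfib⟩ := exists_weight_fiber hU hV hd h0 hρ0 hρ C
  obtain ⟨D, hD1, hD⟩ := exists_dropList hS L hL
  obtain ⟨B, hB1, hB⟩ := exists_weight_le hS L
  refine ⟨L.length, D ^ d * (B ^ d * max 1 c⁻¹), ?_, fun m z hz hzpos => ?_⟩
  · exact one_le_mul_of_one_le_of_one_le (one_le_pow₀ hD1)
      (one_le_mul_of_one_le_of_one_le (one_le_pow₀ hB1) (le_max_left _ _))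
  obtain ⟨w, hw, hzw⟩ := hD m z hz
  have hpos : 0 < pairProd w * ∏ i, weight L (w i) := by
    have := hzpos.trans_le hzw
    exact pos_of_mul_pos_right this (by positivity)
  have hw0 : 0 < pairProd w := lt_of_le_of_ne (pairProd_nonneg w) fun h => by
    rw [← h, zero_mul] at hpos; exact lt_irrefl _ hpos
  have hwt : ∀ i, 0 < weight L (w i) := fun i => lt_of_le_of_ne (weight_nonneg L _) fun h => by
    rw [Finset.prod_eq_zero (Finset.mem_univ i) h.symm, mul_zero] at hpos
    exact lt_irrefl _ hpos
  choose y hy hprod hylow using fun k => hfib (w k) (hS _ (hw k)) (hwt k).ne'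
  refine ⟨w, fun p => y p.2 p.1, hw, fun l k => hy k l, hw0,
    fun k => (mul_pos hc (hwt k)).trans_le (hylow k), ?_, ?_⟩
  · have hpf := pairProd_fibers (F := lift U V) (ρ := ρ) (w := w)
      (y := fun p : Fin d × Fin m => y p.2 p.1) (fun l k => hy k l) (fun k x => hprod k x)
    rw [hpf]
    have : (ρ ^ d) ^ (m * m - m) * R ^ (m * m - m) = 1 := by rw [← mul_pow, hρ, one_pow]
    rw [mul_assoc, mul_right_comm, this, one_mul]
  -- One factor of the weight is compared with the fibre; the other `d - 1` are merely bounded.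
  · have h1 : ∀ k, weight L (w k) ^ d ≤ (B ^ d * max 1 c⁻¹) * pairProd (y k) := by
      intro k
      have h2 : weight L (w k) ≤ max 1 c⁻¹ * pairProd (y k) := by
        have h3 : weight L (w k) ≤ c⁻¹ * pairProd (y k) := by
          rw [inv_mul_eq_div, le_div_iff₀ hc, mul_comm]; exact hylow k
        exact h3.trans (mul_le_mul_of_nonneg_right (le_max_right _ _) (pairProd_nonneg _))
      have h4 : weight L (w k) ^ (d - 1) ≤ B ^ d :=
        (pow_le_pow_left₀ (hwt k).le (hB _ (hw k)) _).trans
          (pow_le_pow_right₀ hB1 (Nat.sub_le d 1))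
      calc weight L (w k) ^ d = weight L (w k) ^ (d - 1) * weight L (w k) := by
            rw [← pow_succ]; congr 1; omega
        _ ≤ B ^ d * (max 1 c⁻¹ * pairProd (y k)) :=
            mul_le_mul h4 h2 (hwt k).le (by positivity)
        _ = _ := by ring
    have hQ : 0 ≤ ∏ k, pairProd (y k) := Finset.prod_nonneg fun k _ => pairProd_nonneg _
    calc pairProd z ^ d ≤ (D ^ (m + 1) * (pairProd w * ∏ i, weight L (w i))) ^ d :=
          pow_le_pow_left₀ hzpos.le hzw d
      _ = (D ^ d) ^ (m + 1) * (pairProd w ^ d * ∏ i, weight L (w i) ^ d) := by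
          rw [mul_pow, mul_pow, Finset.prod_pow, ← pow_mul, ← pow_mul, mul_comm d]
      _ ≤ (D ^ d) ^ (m + 1) * (pairProd w ^ d *
          ∏ i, ((B ^ d * max 1 c⁻¹) * pairProd (y i))) := by
          gcongr with i _
          · exact fun i _ => pow_nonneg (hwt i).le _
          · exact h1 i
      _ = (D ^ d) ^ (m + 1) * (B ^ d * max 1 c⁻¹) ^ m *
          ((∏ i, pairProd (y i)) * pairProd w ^ d) := by
          rw [Finset.prod_mul_distrib]; simp; ring
      _ ≤ (D ^ d) ^ (m + 1) * (B ^ d * max 1 c⁻¹) ^ (m + 1) *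
          ((∏ i, pairProd (y i)) * pairProd w ^ d) := by
          have : 1 ≤ B ^ d * max 1 c⁻¹ :=
            one_le_mul_of_one_le_of_one_le (one_le_pow₀ hB1) (le_max_left _ _)
          gcongr
          exact Nat.le_succ m
      _ = _ := by rw [← mul_pow]

lemma supPairProd_pow_le [IsAlgClosed K] [CharZero K] (hU : U.IsHomogeneous d)
    (hV : V.IsHomogeneous d) (hd : 2 ≤ d)
    (h0 : ∀ z : Fin 2 → K, MvPolynomial.eval z U = 0 → MvPolynomial.eval z V = 0 → z = 0)
    (hS : ∀ z ∈ S, ‖z‖ ≤ C) (hSF : ∀ z, lift U V z ∈ S → z ∈ S) :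
    ∃ (N : ℕ) (D : ℝ), 1 ≤ D ∧ ∀ m, supPairProd S (m + N) ^ d ≤
      D ^ (m + 1) * (‖formResultant d U V‖ ^ (m * m - m) * supPairProd S (d * m)) := by
  obtain ⟨N, D, hD1, h⟩ := exists_fiber_tuple hU hV hd h0 hS
  refine ⟨N, 4 ^ d * D, one_le_mul_of_one_le_of_one_le (one_le_pow₀ (by norm_num)) hD1,
    fun m => ?_⟩
  rcases (supPairProd_nonneg (S := S) (m + N)).eq_or_lt with h1 | h1
  · rw [← h1, zero_pow (by omega)]
    have := supPairProd_nonneg (S := S) (d * m)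
    positivity
  obtain ⟨z, hz, hz'⟩ := exists_pairProd_ge h1
  have hzpos : 0 < pairProd z := by linarith
  obtain ⟨w, y, hw, hy, -, -, he, hle⟩ := h m z hz hzpos
  rw [← he] at hle
  have h2 : pairProd y ≤ supPairProd S (d * m) := by
    rw [← pairProd_comp_equiv finProdFinEquiv.symm y]
    exact pairProd_le_sup hS fun i => hSF _ (by
      change lift U V (y (_, _)) ∈ S
      rw [hy]; exact hw _)
  calc supPairProd S (m + N) ^ d ≤ (4 * pairProd z) ^ d := pow_le_pow_left₀ h1.le hz' d
    _ = (4 ^ d) * pairProd z ^ d := mul_pow _ _ _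
    _ ≤ (4 ^ d) ^ (m + 1) * (D ^ (m + 1) *
        (supPairProd S (d * m) * ‖formResultant d U V‖ ^ (m * m - m))) := by
        have h3 : (4 : ℝ) ^ d ≤ (4 ^ d) ^ (m + 1) :=
          le_self_pow₀ (one_le_pow₀ (by norm_num)) (by omega)
        refine mul_le_mul h3 (hle.trans ?_) (by positivity) (by positivity)
        gcongr
    _ = _ := by rw [mul_pow]; ring

end

end Pullback

/-! ### Transition determinants and interpolation: the upper comparison -/

section Upper

open scoped Kronecker

variable {d m : ℕ} {U V : MvPolynomial (Fin 2) K}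

/-- The form `X^a Y^(d-1-a) U^i V^(m-1-i)`. -/
def productForm (U V : MvPolynomial (Fin 2) K) (q : Fin d × Fin m) : MvPolynomial (Fin 2) K :=
  (MvPolynomial.X 0 ^ (q.1 : ℕ) * MvPolynomial.X 1 ^ (q.1.rev : ℕ)) *
    (U ^ (q.2 : ℕ) * V ^ (q.2.rev : ℕ))

lemma eval_productForm (z : Fin 2 → K) (q : Fin d × Fin m) :
    MvPolynomial.eval z (productForm U V q) =
      monomialVec d z q.1 * monomialVec m (lift U V z) q.2 := by
  simp [productForm, monomialVec, lift]

lemma isHomogeneous_productForm (hU : U.IsHomogeneous d) (hV : V.IsHomogeneous d)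
    (q : Fin d × Fin m) : (productForm U V q).IsHomogeneous (d * m - 1) := by
  have h := ((((MvPolynomial.isHomogeneous_X K (0 : Fin 2)).pow (q.1 : ℕ)).mul
    ((MvPolynomial.isHomogeneous_X K (1 : Fin 2)).pow (q.1.rev : ℕ))).mul
    ((hU.pow (q.2 : ℕ)).mul (hV.pow (q.2.rev : ℕ))))
  have h1 : (q.1 : ℕ) + q.1.rev + 1 = d := by rw [Fin.val_rev]; omega
  have h2 : (q.2 : ℕ) + q.2.rev + 1 = m := by rw [Fin.val_rev]; omega
  have h3 : 1 * (q.1 : ℕ) + 1 * q.1.rev + (d * q.2 + d * q.2.rev) = d * m - 1 := by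
    have : d * ((q.2 : ℕ) + q.2.rev + 1) = d * m := by rw [h2]
    have h4 : d * q.2 + d * q.2.rev + d = d * m := by rw [← this]; ring
    omega
  rw [h3] at h
  exact h

/-- The coefficient matrix of the forms `productForm` in the monomial basis. -/
def transitionMatrix (d m : ℕ) (U V : MvPolynomial (Fin 2) K) :
    Matrix (Fin d × Fin m) (Fin d × Fin m) K :=
  .of fun q r => (dehomogenize (productForm U V r)).coeff (finProdFinEquiv q)

/-- The values of the forms `productForm` at a tuple of points. -/
def productMatrix (U V : MvPolynomial (Fin 2) K) (z : Fin d × Fin m → Fin 2 → K) :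
    Matrix (Fin d × Fin m) (Fin d × Fin m) K :=
  .of fun p q => monomialVec d (z p) q.1 * monomialVec m (lift U V (z p)) q.2

lemma productMatrix_eq_mul_transitionMatrix (hU : U.IsHomogeneous d) (hV : V.IsHomogeneous d)
    (z : Fin d × Fin m → Fin 2 → K) :
    productMatrix U V z = formMatrix finProdFinEquiv z * transitionMatrix d m U V := by
  ext p q
  have hpos : d * m - 1 + 1 = d * m :=
    Nat.sub_add_cancel (Nat.mul_pos (Fin.pos q.1) (Fin.pos q.2))
  rw [productMatrix, Matrix.of_apply, ← eval_productForm,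
    eval_eq_sum_dehomogenize (isHomogeneous_productForm hU hV q), hpos, Finset.sum_range,
    Matrix.mul_apply, ← finProdFinEquiv.sum_comp]
  refine Finset.sum_congr rfl fun r _ => ?_
  have h1 : d * m - 1 - (finProdFinEquiv r : Fin (d * m)) =
      ((finProdFinEquiv r : Fin (d * m)).rev : ℕ) := by
    rw [Fin.val_rev]; omega
  rw [h1, mul_comm]
  rfl

/-- Used with delta coefficients on a fibre tuple, where the first factor is block diagonal, and
with Lagrange coefficients on an arbitrary tuple. -/
lemma productMatrix_eq_mul_kronecker (z : Fin d × Fin m → Fin 2 → K) (w : Fin m → Fin 2 → K)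
    (c : Fin d × Fin m → Fin m → K)
    (hc : ∀ p i, monomialVec m (lift U V (z p)) i = ∑ k, c p k * monomialVec m (w k) i) :
    productMatrix U V z =
      (Matrix.of fun p q : Fin d × Fin m => monomialVec d (z p) q.1 * c p q.2) *
        ((1 : Matrix (Fin d) (Fin d) K) ⊗ₖ formMatrix (Equiv.refl _) w) := by
  ext p q
  rw [productMatrix, Matrix.of_apply, hc, Matrix.mul_apply, Fintype.sum_prod_type,
    Finset.sum_eq_single q.1]
  · simp [formMatrix, Finset.mul_sum, mul_assoc]
  · intro a _ ha
    exact Finset.sum_eq_zero fun i _ => by simp [ha]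
  · simp

lemma norm_det_one_kronecker (w : Fin m → Fin 2 → K) :
    ‖((1 : Matrix (Fin d) (Fin d) K) ⊗ₖ formMatrix (Equiv.refl _) w).det‖ ^ 2 =
      pairProd w ^ d := by
  rw [Matrix.det_kronecker, Matrix.det_one, one_pow, one_mul, Fintype.card_fin, norm_pow,
    ← norm_det_formMatrix_sq (Equiv.refl _), ← pow_mul, ← pow_mul, mul_comm]

lemma norm_det_productMatrix_fibers {w : Fin m → Fin 2 → K} {y : Fin d × Fin m → Fin 2 → K}
    (hy : ∀ l k, lift U V (y (l, k)) = w k) :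
    ‖(productMatrix U V y).det‖ ^ 2 = (∏ k, pairProd fun l => y (l, k)) * pairProd w ^ d := by
  have h : (Matrix.of fun p q : Fin d × Fin m =>
      monomialVec d (y p) q.1 * (if p.2 = q.2 then (1 : K) else 0)) =
      Matrix.blockDiagonal fun k => formMatrix (Equiv.refl _) fun l => y (l, k) := by
    ext ⟨l, k⟩ ⟨a, k'⟩
    by_cases hk : k = k'
    · subst hk; simp [formMatrix]
    · simp [Matrix.blockDiagonal_apply, hk]
  rw [productMatrix_eq_mul_kronecker y w (fun p k => if p.2 = k then 1 else 0)
    (fun p i => by obtain ⟨l, k⟩ := p; simp [hy]), Matrix.det_mul, norm_mul, mul_pow,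
    norm_det_one_kronecker, h, Matrix.det_blockDiagonal, norm_prod, ← Finset.prod_pow]
  simp only [norm_det_formMatrix_sq]

/-- The transition matrix does not depend on the points, so one fibre tuple with nonzero product
determines the size of its determinant. -/
lemma norm_det_transitionMatrix {w : Fin m → Fin 2 → K} {y : Fin d × Fin m → Fin 2 → K} {R : ℝ}
    (hU : U.IsHomogeneous d) (hV : V.IsHomogeneous d)
    (hy : ∀ l k, lift U V (y (l, k)) = w k) (hy0 : pairProd y ≠ 0)
    (h : pairProd y * R = (∏ k, pairProd fun l => y (l, k)) * pairProd w ^ d) :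
    ‖(transitionMatrix d m U V).det‖ ^ 2 = R := by
  have h1 := norm_det_productMatrix_fibers hy
  rw [productMatrix_eq_mul_transitionMatrix hU hV, Matrix.det_mul, norm_mul, mul_pow,
    norm_det_formMatrix_sq, ← h] at h1
  exact mul_left_cancel₀ hy0 h1

lemma norm_det_le {n : Type*} [Fintype n] [DecidableEq n] (A : Matrix n n K) {x : ℝ}
    (hx : ∀ i j, ‖A i j‖ ≤ x) :
    ‖A.det‖ ≤ (Fintype.card n).factorial * x ^ Fintype.card n := by
  have := Matrix.det_le (A := A) (abv := (NormedField.toAbsoluteValue K)) (x := x) hx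
  rwa [nsmul_eq_mul] at this

variable {S : Set (Fin 2 → K)} {C : ℝ}

/-- Choose nearly extremal nodes `w`. Replacing one by `F(z p)` stays in `S`, so the Lagrange
coefficients are at most 2. The crude Leibniz bound for the remaining determinant suffices, since
`log (dm)! = o(m²)`. -/
lemma norm_det_productMatrix_le (hS : ∀ z ∈ S, ‖z‖ ≤ C) (hC : 1 ≤ C)
    (hSF : ∀ z ∈ S, lift U V z ∈ S) (hm : 0 < supPairProd S m)
    {z : Fin d × Fin m → Fin 2 → K} (hz : ∀ p, z p ∈ S) :
    ‖(productMatrix U V z).det‖ ^ 2 ≤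
      ((d * m).factorial * (2 * C ^ d) ^ (d * m)) ^ 2 * supPairProd S m ^ d := by
  obtain ⟨w, hw, hw'⟩ := exists_pairProd_ge hm
  have hwpos : 0 < pairProd w := by linarith
  set M := formMatrix (Equiv.refl _) w with hM
  have hdet : 0 < ‖M.det‖ := by
    have h := norm_det_formMatrix_sq (Equiv.refl _) w
    refine lt_of_le_of_ne (norm_nonneg _) fun h' => ?_
    rw [← hM, ← h'] at h
    simp at h
    linarith
  set c : Fin d × Fin m → Fin m → K := fun p k =>
    (formMatrix (Equiv.refl _) (Function.update w k (lift U V (z p)))).det / M.det with hcdef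
  have hc : ∀ p i, monomialVec m (lift U V (z p)) i = ∑ k, c p k * monomialVec m (w k) i := by
    intro p i
    have h := det_mul_monomialVec (Equiv.refl _) w (lift U V (z p)) i
    rw [← hM] at h
    have h0 : M.det ≠ 0 := norm_pos_iff.1 hdet
    refine mul_left_cancel₀ h0 (h.trans ?_)
    rw [Finset.mul_sum]
    refine Finset.sum_congr rfl fun k _ => ?_
    rw [hcdef]
    field_simp
  have hcle : ∀ p k, ‖c p k‖ ≤ 2 := by
    intro p k
    rw [hcdef]
    simp only
    rw [norm_div, div_le_iff₀ hdet]
    refine (pow_le_pow_iff_left₀ (norm_nonneg _) (by positivity) two_ne_zero).1 ?_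
    rw [mul_pow, norm_det_formMatrix_sq, hM, norm_det_formMatrix_sq]
    refine (pairProd_le_sup hS fun i => ?_).trans (hw'.trans_eq (by norm_num))
    by_cases hi : i = k
    · subst hi; simpa using hSF _ (hz p)
    · simpa [hi] using hw i
  rw [productMatrix_eq_mul_kronecker z w c hc, Matrix.det_mul, norm_mul, mul_pow,
    norm_det_one_kronecker]
  have h1 := norm_det_le (Matrix.of fun p q : Fin d × Fin m => monomialVec d (z p) q.1 * c p q.2)
    (x := 2 * C ^ d) (fun p q => by
      rw [Matrix.of_apply, norm_mul, mul_comm]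
      refine mul_le_mul (hcle _ _) ((norm_monomialVec_le (hS _ (hz p)) _).trans ?_)
        (norm_nonneg _) (by norm_num)
      exact pow_le_pow_right₀ hC (Nat.sub_le d 1))
  rw [Fintype.card_prod, Fintype.card_fin, Fintype.card_fin] at h1
  have h2 := pairProd_le_sup hS hw
  have h3 := pairProd_nonneg w
  gcongr

lemma supPairProd_mul_le [IsAlgClosed K] [CharZero K] (hU : U.IsHomogeneous d)
    (hV : V.IsHomogeneous d) (hd : 2 ≤ d)
    (h0 : ∀ z : Fin 2 → K, MvPolynomial.eval z U = 0 → MvPolynomial.eval z V = 0 → z = 0)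
    (hS : ∀ z ∈ S, ‖z‖ ≤ C) (hC : 1 ≤ C) (hSF : ∀ z ∈ S, lift U V z ∈ S)
    (hpos : ∀ n, 0 < supPairProd S n) (m : ℕ) :
    supPairProd S (d * m) * ‖formResultant d U V‖ ^ (m * m - m) ≤
      4 * (((d * m).factorial * (2 * C ^ d) ^ (d * m)) ^ 2 * supPairProd S m ^ d) := by
  obtain ⟨N, D, hD1, h⟩ := exists_fiber_tuple hU hV hd h0 hS
  -- This auxiliary tuple serves only to evaluate the transition determinant; the estimate is made
  -- at `z` below.
  obtain ⟨z', hz', hz'1⟩ := exists_pairProd_ge (hpos (m + N))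
  obtain ⟨w, y, -, hy, hwpos, hypos, he, -⟩ := h m z' hz' (by linarith [hpos (m + N)])
  have hy0 : pairProd y ≠ 0 := by
    intro h1
    rw [h1, zero_mul] at he
    exact (mul_pos (Finset.prod_pos fun k _ => hypos k) (pow_pos hwpos d)).ne he
  have hT := norm_det_transitionMatrix hU hV hy hy0 he
  obtain ⟨z, hz, hz1⟩ := exists_pairProd_ge (hpos (d * m))
  have h2 := norm_det_productMatrix_le hS hC hSF (hpos m) (z := z ∘ finProdFinEquiv)
    fun p => hz _
  rw [productMatrix_eq_mul_transitionMatrix hU hV, Matrix.det_mul, norm_mul, mul_pow,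
    norm_det_formMatrix_sq, hT, pairProd_comp_equiv] at h2
  have := mul_le_mul_of_nonneg_right hz1 (pow_nonneg (norm_nonneg (formResultant d U V)) (m * m - m))
  linarith

end Upper

/-! ### Passage to the limit -/

section Limit

lemma tendsto_mul_sub_one_mul_div_sq {u : ℕ → ℝ} {l : ℝ} (hu : Tendsto u atTop (𝓝 l)) (a b : ℕ)
    (ha : a ≠ 0) :
    Tendsto (fun m : ℕ => (((a * m + b : ℕ) : ℝ) * (((a * m + b : ℕ) : ℝ) - 1)) * u (a * m + b) /
      (m : ℝ) ^ 2) atTop (𝓝 ((a : ℝ) ^ 2 * l)) := by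
  have h1 : Tendsto (fun m : ℕ => a * m + b) atTop atTop :=
    tendsto_atTop_mono (fun m => (Nat.le_mul_of_pos_left m (Nat.pos_of_ne_zero ha)).trans
      (Nat.le_add_right _ _)) tendsto_id
  have h2 : ∀ c : ℝ, Tendsto (fun m : ℕ => (a : ℝ) + c / m) atTop (𝓝 a) := fun c => by
    simpa using tendsto_const_nhds.add (tendsto_const_div_atTop_nhds_zero_nat c)
  have h3 := ((h2 b).mul (h2 (b - 1))).mul (hu.comp h1)
  rw [← sq] at h3
  refine h3.congr' ?_
  filter_upwards [eventually_ne_atTop 0] with m hm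
  have : (m : ℝ) ≠ 0 := Nat.cast_ne_zero.2 hm
  simp only [Function.comp_apply]
  push_cast
  field_simp
  ring

lemma tendsto_log_factorial_div_sq (d : ℕ) (hd : d ≠ 0) :
    Tendsto (fun m : ℕ => Real.log ((d * m).factorial : ℝ) / (m : ℝ) ^ 2) atTop (𝓝 0) := by
  have h1 : Tendsto (fun m : ℕ => ((d * m : ℕ) : ℝ)) atTop atTop :=
    tendsto_natCast_atTop_atTop.comp (tendsto_atTop_mono
      (fun m => Nat.le_mul_of_pos_left m (Nat.pos_of_ne_zero hd)) tendsto_id)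
  have h2 := ((Real.tendsto_pow_log_div_mul_add_atTop 1 0 1 one_ne_zero).comp h1).const_mul
    ((d : ℝ) ^ 2)
  rw [mul_zero] at h2
  refine squeeze_zero' (Eventually.of_forall fun m => ?_) ?_ h2
  · exact div_nonneg (Real.log_natCast_nonneg _) (by positivity)
  · filter_upwards [eventually_ne_atTop 0] with m hm
    have hm' : (0 : ℝ) < m := by positivity
    have hd' : (0 : ℝ) < d := by positivity
    have h3 : Real.log ((d * m).factorial : ℝ) ≤ (d * m : ℕ) * Real.log ((d * m : ℕ) : ℝ) := by
      rw [← Real.log_pow]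
      exact Real.log_le_log (by positivity) (by exact_mod_cast Nat.factorial_le_pow (d * m))
    refine (div_le_div_of_nonneg_right h3 (by positivity)).trans_eq ?_
    simp only [Function.comp_apply]
    push_cast
    field_simp
    ring

/-- Since `log (M n) = n (n - 1) log (δ n)`, division by `m²` removes the shift `N`, the exponential
factors and the factorial. The two bounds become opposite inequalities between `d log l` and `log R
+ d² log l`; the lower bound `c` keeps `log l` finite. -/
lemma tendsto_of_pullback_bounds {δ M : ℕ → ℝ} {c R D E : ℝ} {d N : ℕ} (hd : 2 ≤ d) (hc : 0 < c)
    (hR : 0 < R) (hD : 0 < D) (hE : 0 < E) (hδ : ∀ n, 2 ≤ n → c ≤ δ n)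
    (hanti : ∀ n, 2 ≤ n → δ (n + 1) ≤ δ n) (hM : ∀ n, 2 ≤ n → M n = δ n ^ (n * (n - 1)))
    (hlow : ∀ m, M (m + N) ^ d ≤ D ^ (m + 1) * (R ^ (m * m - m) * M (d * m)))
    (hup : ∀ m, M (d * m) * R ^ (m * m - m) ≤
      4 * (((d * m).factorial * E ^ (d * m)) ^ 2 * M m ^ d)) :
    Tendsto δ atTop (𝓝 (R ^ (-1 / ((d : ℝ) * ((d : ℝ) - 1))))) := by
  obtain ⟨l, hl⟩ : ∃ l, Tendsto δ atTop (𝓝 l) := by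
    refine ⟨_, (tendsto_add_atTop_iff_nat 2).1 (tendsto_atTop_ciInf (f := fun n => δ (n + 2))
      (antitone_nat_of_succ_le fun n => hanti (n + 2) (by omega)) ⟨c, ?_⟩)⟩
    rintro _ ⟨n, rfl⟩
    exact hδ (n + 2) (by omega)
  have hl0 : 0 < l := hc.trans_le (ge_of_tendsto hl (eventually_atTop.2 ⟨2, hδ⟩))
  have hlog : Tendsto (fun n => Real.log (δ n)) atTop (𝓝 (Real.log l)) := hl.log hl0.ne'
  have hMpos : ∀ n, 2 ≤ n → 0 < M n := fun n hn => by
    rw [hM n hn]; exact pow_pos (hc.trans_le (hδ n hn)) _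
  have hlogM : ∀ n, 2 ≤ n → Real.log (M n) = (n : ℝ) * ((n : ℝ) - 1) * Real.log (δ n) := by
    intro n hn
    rw [hM n hn, Real.log_pow, Nat.cast_mul, Nat.cast_sub (by omega), Nat.cast_one]
  have hsq : ∀ m : ℕ, ((m * m - m : ℕ) : ℝ) = (m : ℝ) * ((m : ℝ) - 1) := by
    intro m
    rw [Nat.cast_sub (Nat.le_mul_self m), Nat.cast_mul]; ring
  have hR' : Tendsto (fun m : ℕ => ((m : ℝ) * ((m : ℝ) - 1)) * Real.log R / (m : ℝ) ^ 2) atTop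
      (𝓝 (Real.log R)) := by
    simpa using tendsto_mul_sub_one_mul_div_sq (tendsto_const_nhds (x := Real.log R)) 1 0 one_ne_zero
  have hdm := tendsto_mul_sub_one_mul_div_sq hlog d 0 (by omega)
  have hmN := tendsto_mul_sub_one_mul_div_sq hlog 1 N one_ne_zero
  have hm0 := tendsto_mul_sub_one_mul_div_sq hlog 1 0 one_ne_zero
  simp only [add_zero, one_mul, Nat.cast_one, one_pow] at hdm hmN hm0
  have hlin : ∀ a b : ℝ, Tendsto (fun m : ℕ => ((m : ℝ) * a + b) / (m : ℝ) ^ 2) atTop (𝓝 0) := by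
    intro a b
    have h1 := tendsto_const_div_atTop_nhds_zero_nat (𝕜 := ℝ)
    have h2 := (h1 a).add ((h1 b).mul (h1 1))
    simp only [mul_zero, add_zero] at h2
    refine h2.congr' ?_
    filter_upwards [eventually_ne_atTop 0] with m hm
    have : (m : ℝ) ≠ 0 := Nat.cast_ne_zero.2 hm
    field_simp
  have h1 : (d : ℝ) * Real.log l ≤ 0 + (Real.log R + (d : ℝ) ^ 2 * Real.log l) := by
    refine le_of_tendsto_of_tendsto (hmN.const_mul (d : ℝ))
      ((hlin (Real.log D) (Real.log D)).add (hR'.add hdm)) ?_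
    filter_upwards [eventually_ge_atTop 2] with m hm
    have hdm2 : 2 ≤ d * m := hm.trans (Nat.le_mul_of_pos_left m (by omega))
    have hp := hMpos (d * m) hdm2
    have h := Real.log_le_log (pow_pos (hMpos (m + N) (by omega)) d) (hlow m)
    rw [Real.log_pow, hlogM _ (by omega), Real.log_mul (by positivity) (by positivity),
      Real.log_mul (by positivity) hp.ne', Real.log_pow, Real.log_pow, hlogM _ hdm2, hsq] at h
    rw [← mul_div_assoc, ← add_div, ← add_div]
    refine div_le_div_of_nonneg_right ?_ (by positivity)
    push_cast at h ⊢
    linarith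
  have h2 : (d : ℝ) ^ 2 * Real.log l + Real.log R ≤
      0 + (2 * 0 + (d : ℝ) * Real.log l) := by
    refine le_of_tendsto_of_tendsto (hdm.add hR')
      ((hlin (2 * d * Real.log E) (Real.log 4)).add
        (((tendsto_log_factorial_div_sq d (by omega)).const_mul 2).add (hm0.const_mul (d : ℝ)))) ?_
    filter_upwards [eventually_ge_atTop 2] with m hm
    have hdm2 : 2 ≤ d * m := hm.trans (Nat.le_mul_of_pos_left m (by omega))
    have hp := hMpos (d * m) hdm2
    have hp' := hMpos m hm
    have hf : (0 : ℝ) < (d * m).factorial := by exact_mod_cast Nat.factorial_pos _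
    have h := Real.log_le_log (by positivity) (hup m)
    rw [Real.log_mul hp.ne' (by positivity), Real.log_mul (by norm_num) (by positivity),
      Real.log_mul (by positivity) (by positivity), Real.log_pow, Real.log_pow, Real.log_pow,
      Real.log_mul hf.ne' (by positivity), Real.log_pow, hlogM _ hdm2, hlogM _ hm, hsq] at h
    rw [← mul_div_assoc, ← mul_div_assoc, ← add_div, ← add_div, ← add_div]
    refine div_le_div_of_nonneg_right ?_ (by positivity)
    push_cast at h ⊢
    linarith
  have hd0 : (d : ℝ) * ((d : ℝ) - 1) ≠ 0 := by
    have : (2 : ℝ) ≤ d := by exact_mod_cast hd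
    have : 0 < (d : ℝ) * ((d : ℝ) - 1) := mul_pos (by linarith) (by linarith)
    exact this.ne'
  have h3 : Real.log l = -1 / ((d : ℝ) * ((d : ℝ) - 1)) * Real.log R := by
    rw [div_mul_eq_mul_div, eq_div_iff hd0]
    linarith
  have h4 : l = R ^ (-1 / ((d : ℝ) * ((d : ℝ) - 1))) := by
    rw [← Real.exp_log hl0, h3, Real.rpow_def_of_pos hR, mul_comm]
  rw [← h4]
  exact hl

end Limit

/-! ### Monotonicity, positivity and the general theorem -/

section TransfiniteDiameter

variable {S : Set (Fin 2 → K)} {C : ℝ}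

lemma transfiniteDiameterSeq_eq (S : Set (Fin 2 → K)) (n : ℕ) :
    transfiniteDiameterSeq S n =
      sSup ((fun x : ℝ => x ^ (1 / ((n : ℝ) * ((n : ℝ) - 1)))) ''
        (pairProd '' {z : Fin n → Fin 2 → K | ∀ i, z i ∈ S})) := by
  rw [transfiniteDiameterSeq, Set.image_image]
  congr 2
  ext z
  exact Real.finsetProd_rpow _ _ (fun _ _ => wedgeDist_nonneg _ _) _

lemma transfiniteDiameterSeq_nonneg (S : Set (Fin 2 → K)) (n : ℕ) :
    0 ≤ transfiniteDiameterSeq S n := by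
  rw [transfiniteDiameterSeq_eq]
  refine Real.sSup_nonneg ?_
  rintro _ ⟨_, ⟨z, -, rfl⟩, rfl⟩
  exact Real.rpow_nonneg (pairProd_nonneg z) _

lemma supPairProd_eq_pow (hS : ∀ z ∈ S, ‖z‖ ≤ C) (hne : S.Nonempty) {n : ℕ} (hn : 2 ≤ n) :
    supPairProd S n = transfiniteDiameterSeq S n ^ (n * (n - 1)) := by
  have hk : n * (n - 1) ≠ 0 := Nat.mul_ne_zero (by omega) (by omega)
  have hcast : (1 / ((n : ℝ) * ((n : ℝ) - 1))) = ((n * (n - 1) : ℕ) : ℝ)⁻¹ := by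
    rw [Nat.cast_mul, Nat.cast_sub (by omega), Nat.cast_one, one_div]
  obtain ⟨x, hx⟩ := hne
  have hne' : (pairProd '' {z : Fin n → Fin 2 → K | ∀ i, z i ∈ S}).Nonempty :=
    ⟨_, fun _ => x, fun _ => hx, rfl⟩
  have h0 := transfiniteDiameterSeq_nonneg S n
  rw [transfiniteDiameterSeq_eq, hcast] at h0 ⊢
  refine le_antisymm (csSup_le hne' ?_) ?_
  · rintro _ ⟨z, hz, rfl⟩
    rw [← Real.rpow_inv_natCast_pow (pairProd_nonneg z) hk]
    refine pow_le_pow_left₀ (Real.rpow_nonneg (pairProd_nonneg z) _) ?_ _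
    refine le_csSup ⟨supPairProd S n ^ ((n * (n - 1) : ℕ) : ℝ)⁻¹, ?_⟩
      ⟨pairProd z, ⟨z, hz, rfl⟩, rfl⟩
    rintro _ ⟨_, ⟨z, hz, rfl⟩, rfl⟩
    exact Real.rpow_le_rpow (pairProd_nonneg z) (pairProd_le_sup hS hz) (by positivity)
  · rw [← Real.rpow_inv_natCast_pow (supPairProd_nonneg (S := S) n) hk]
    refine pow_le_pow_left₀ h0 (csSup_le (hne'.image _) ?_) _
    rintro _ ⟨_, ⟨z, hz, rfl⟩, rfl⟩
    exact Real.rpow_le_rpow (pairProd_nonneg z) (pairProd_le_sup hS hz) (by positivity)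

/-- Each ordered pair survives the omission of `m - 1` of the `m + 1` points. In the proof the
omitted factors, over all `k`, multiply to `pairProd z ^ 2`, which is cancelled. -/
lemma pairProd_pow_eq_prod {m : ℕ} (hm : m ≠ 0) {z : Fin (m + 1) → Fin 2 → K}
    (hz : pairProd z ≠ 0) :
    pairProd z ^ (m - 1) = ∏ k : Fin (m + 1), pairProd fun j => z (k.succAbove j) := by
  have h1 : ∀ k, pairProd z = (pairProd fun j => z (k.succAbove j)) *
      ∏ j, wedgeDist (z (k.succAbove j)) (z k) ^ 2 := fun k => by
    rw [← pairProd_update, Function.update_eq_self]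
  have h2 : ∏ k, ∏ j, wedgeDist (z (k.succAbove j)) (z k) = pairProd z := by
    rw [pairProd, prod_offDiag_eq (fun i j => wedgeDist (z i) (z j))]
    refine Finset.prod_congr rfl fun k _ => ?_
    rw [prod_erase_eq_prod_succAbove]
    exact Finset.prod_congr rfl fun j _ => wedgeDist_comm _ _
  have h3 : pairProd z ^ (m + 1) =
      (∏ k : Fin (m + 1), pairProd fun j => z (k.succAbove j)) * pairProd z ^ 2 := by
    calc pairProd z ^ (m + 1) = ∏ _k : Fin (m + 1), pairProd z := by simp
      _ = _ := by
        rw [Finset.prod_congr rfl fun k _ => h1 k, Finset.prod_mul_distrib]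
        simp only [Finset.prod_pow, h2]
  refine mul_right_cancel₀ (pow_ne_zero 2 hz) ?_
  rw [← h3, ← pow_add]
  congr 1
  omega

/-- Fekete's argument: take the geometric mean over the `n + 1` ways of omitting a point. -/
lemma transfiniteDiameterSeq_succ_le (hS : ∀ z ∈ S, ‖z‖ ≤ C) (hne : S.Nonempty) {n : ℕ}
    (hn : 2 ≤ n) : transfiniteDiameterSeq S (n + 1) ≤ transfiniteDiameterSeq S n := by
  have h0 := transfiniteDiameterSeq_nonneg S n
  have hk : (n + 1) * (n + 1 - 1) ≠ 0 := Nat.mul_ne_zero (by omega) (by omega)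
  refine (pow_le_pow_iff_left₀ (transfiniteDiameterSeq_nonneg S _) h0 hk).1 ?_
  rw [← supPairProd_eq_pow hS hne (by omega)]
  obtain ⟨x, hx⟩ := id hne
  refine csSup_le ⟨_, fun _ => x, fun _ => hx, rfl⟩ ?_
  rintro _ ⟨z, hz, rfl⟩
  rcases (pairProd_nonneg z).eq_or_lt with h | h
  · rw [← h]; positivity
  refine (pow_le_pow_iff_left₀ h.le (by positivity) (show n - 1 ≠ 0 by omega)).1 ?_
  rw [pairProd_pow_eq_prod (by omega) h.ne']
  refine (Finset.prod_le_prod (fun _ _ => pairProd_nonneg _) fun k _ =>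
    pairProd_le_sup hS (n := n) fun j => hz _).trans_eq ?_
  rw [Finset.prod_const, Finset.card_univ, Fintype.card_fin, supPairProd_eq_pow hS hne hn,
    ← pow_mul, ← pow_mul]
  congr 1
  simp only [Nat.add_sub_cancel]
  ring

/-- At a root of unity the product of the differences to the others is the derivative of `X^n - 1`,
of norm `‖n‖`. -/
lemma pairProd_rootsOfUnity [IsAlgClosed K] {n : ℕ} (hn : n ≠ 0) (s : K) :
    ∃ z : Fin n → Fin 2 → K, (∀ i, ‖z i‖ ≤ ‖s‖) ∧
      pairProd z = (‖s‖ ^ 2) ^ (n * (n - 1)) * ‖(n : K)‖ ^ n := by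
  have hdeg : (Polynomial.X ^ n - Polynomial.C (1 : K)).natDegree = n :=
    Polynomial.natDegree_X_pow_sub_C
  obtain ⟨t, ht⟩ := exists_roots_eq_map hdeg
  have hq := eq_C_mul_prod_of_roots ht
  have hpow : ∀ l, t l ^ n = 1 := fun l => by
    have := eval_root_eq_zero ht l
    simpa [sub_eq_zero] using this
  have hnorm : ∀ l, ‖t l‖ = 1 := fun l =>
    (pow_eq_one_iff_of_nonneg (norm_nonneg _) hn).1 (by rw [← norm_pow, hpow, norm_one])
  have hlead : (Polynomial.X ^ n - Polynomial.C (1 : K)).leadingCoeff = 1 :=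
    Polynomial.leadingCoeff_X_pow_sub_C (Nat.pos_of_ne_zero hn)
  have hder : ∀ l, ∏ j ∈ Finset.univ.erase l, ‖t l - t j‖ = ‖(n : K)‖ := by
    intro l
    have h := eval_derivative_of_eq_prod hq l
    rw [hlead, one_mul] at h
    rw [← norm_prod, ← h, Polynomial.derivative_sub, Polynomial.derivative_C,
      Polynomial.derivative_X_pow]
    simp [hnorm]
  refine ⟨fun l => s • ![t l, 1], fun i => ?_, ?_⟩
  · rw [norm_smul]
    refine mul_le_of_le_one_right (norm_nonneg _) ?_
    rw [pi_norm_le_iff_of_nonneg zero_le_one, Fin.forall_fin_two]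
    simp [hnorm]
  · rw [pairProd, prod_offDiag_eq (fun i j => wedgeDist (s • ![t i, 1]) (s • ![t j, 1]))]
    have h : ∀ i j, wedgeDist (s • ![t i, 1]) (s • ![t j, 1]) = ‖s‖ ^ 2 * ‖t i - t j‖ := by
      intro i j
      rw [wedgeDist_eq, wedge_smul_left, wedge_smul_right, norm_mul, norm_mul]
      simp [wedge]; ring
    simp only [h, Finset.prod_mul_distrib, hder]
    simp [← pow_mul, mul_comm, mul_assoc]

/-- Scaled roots of unity lose only `‖n‖ ^ n ≥ n ^ (-n) ≥ 2 ^ (-n (n - 1))`, because `n ≤ 2 ^ (n -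
1)`; hence the division by 2. -/
lemma pow_le_supPairProd [IsAlgClosed K]
    (hnat : ∀ n : ℕ, n ≠ 0 → 1 ≤ n * ‖(n : K)‖) (hS : ∀ z ∈ S, ‖z‖ ≤ C) {s : K}
    (hs : ∀ z, ‖z‖ ≤ ‖s‖ → z ∈ S) (n : ℕ) :
    (‖s‖ ^ 2 / 2) ^ (n * (n - 1)) ≤ supPairProd S n := by
  by_cases hn : n = 0
  · subst hn
    have := pairProd_le_sup hS (n := 0) (z := fun _ => 0) (fun i => i.elim0)
    simpa [pairProd] using this
  obtain ⟨z, hz, hz'⟩ := pairProd_rootsOfUnity hn s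
  refine le_trans ?_ (pairProd_le_sup hS fun i => hs _ (hz i))
  rw [hz', div_pow, div_le_iff₀ (by positivity), mul_assoc]
  refine le_mul_of_one_le_right (by positivity) ?_
  rw [mul_comm n, pow_mul, ← mul_pow]
  refine one_le_pow₀ ((hnat n hn).trans ?_)
  rw [mul_comm]
  gcongr
  have : n ≤ 2 ^ (n - 1) := by
    have := Nat.lt_two_pow_self (n := n - 1)
    omega
  exact_mod_cast this

/-- The homogeneous transfinite diameter of a filled Julia set, over an algebraically closed
normed field of characteristic zero. -/
theorem hasTransfiniteDiameter_filledJulia [IsAlgClosed K] [CharZero K]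
    (hnat : ∀ n : ℕ, n ≠ 0 → 1 ≤ n * ‖(n : K)‖)
    (hsmall : ∀ r : ℝ, 0 < r → ∃ s : K, s ≠ 0 ∧ ‖s‖ ≤ r)
    {d : ℕ} {U V : MvPolynomial (Fin 2) K} (hd : 2 ≤ d)
    (hU : U.IsHomogeneous d) (hV : V.IsHomogeneous d)
    (h0 : ∀ z : Fin 2 → K, MvPolynomial.eval z U = 0 → MvPolynomial.eval z V = 0 → z = 0) :
    HasTransfiniteDiameter (filledJulia U V)
      (‖formResultant d U V‖ ^ (-1 / ((d : ℝ) * ((d : ℝ) - 1)))) := by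
  have hb := isBounded_filledJulia hU hV hd h0
  refine ⟨hb, ?_⟩
  obtain ⟨C', hC'⟩ := isBounded_iff_forall_norm_le.1 hb
  have hS : ∀ z ∈ filledJulia U V, ‖z‖ ≤ max 1 C' := fun z hz => (hC' z hz).trans (le_max_right _ _)
  obtain ⟨r, hr, hball⟩ := exists_ball_subset_filledJulia hU hV hd
  obtain ⟨s, hs0, hsr⟩ := hsmall r hr
  have hs : ∀ z, ‖z‖ ≤ ‖s‖ → z ∈ filledJulia U V := fun z hz => hball z (hz.trans hsr)
  have hc : 0 < ‖s‖ ^ 2 / 2 := by have := norm_pos_iff.2 hs0; positivity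
  have hle := pow_le_supPairProd hnat hS hs
  have hne : (filledJulia U V).Nonempty := ⟨0, hs 0 (by simp)⟩
  obtain ⟨N, D, hD1, hlow⟩ := supPairProd_pow_le hU hV hd h0 hS fun z => lift_mem_filledJulia.1
  have hup := supPairProd_mul_le hU hV hd h0 hS (le_max_left _ _)
    (fun z => lift_mem_filledJulia.2) fun n => (pow_pos hc _).trans_le (hle n)
  refine tendsto_of_pullback_bounds hd hc (norm_pos_iff.2 (formResultant_ne_zero hU hV h0))
    (zero_lt_one.trans_le hD1) (by positivity) (fun n hn => ?_)
    (fun n hn => transfiniteDiameterSeq_succ_le hS hne hn)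
    (fun n hn => supPairProd_eq_pow hS hne hn) hlow hup
  refine (pow_le_pow_iff_left₀ hc.le (transfiniteDiameterSeq_nonneg _ _)
    (Nat.mul_ne_zero (show n ≠ 0 by omega) (show n - 1 ≠ 0 by omega))).1 ?_
  rw [← supPairProd_eq_pow hS hne hn]
  exact hle n

lemma exists_norm_le_of_nontriviallyNormed (L : Type*) [NontriviallyNormedField L] (r : ℝ)
    (hr : 0 < r) : ∃ s : L, s ≠ 0 ∧ ‖s‖ ≤ r := by
  obtain ⟨s, hs, hsr⟩ := NormedField.exists_norm_lt L hr
  exact ⟨s, norm_pos_iff.1 hs, hsr.le⟩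

lemma one_le_mul_norm_natCast_padicComplex (p : ℕ) [Fact p.Prime] (n : ℕ) (hn : n ≠ 0) :
    1 ≤ n * ‖(n : PadicComplex p)‖ := by
  have h : ‖(n : PadicComplex p)‖ = ‖(n : ℚ_[p])‖ := by
    rw [← PadicComplex.norm_extends' p]
    simp
  have hp : (0 : ℝ) < p := by exact_mod_cast (Fact.out : p.Prime).pos
  have hle : (p : ℝ) ^ padicValNat p n ≤ n := by
    exact_mod_cast Nat.le_of_dvd (Nat.pos_of_ne_zero hn) pow_padicValNat_dvd
  rw [h, Padic.norm_eq_zpow_neg_valuation (Nat.cast_ne_zero.2 hn), Padic.valuation_natCast,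
    zpow_neg, zpow_natCast, ← div_eq_mul_inv, one_le_div (by positivity)]
  exact hle

end TransfiniteDiameter

end HomogeneousDynamics

end

theorem mainTheorem4 :
    (∀ (d : ℕ) (U V : MvPolynomial (Fin 2) ℂ), 2 ≤ d →
      U.IsHomogeneous d → V.IsHomogeneous d →
      (∀ z : Fin 2 → ℂ, MvPolynomial.eval z U = 0 → MvPolynomial.eval z V = 0 → z = 0) →
      HomogeneousDynamics.HasTransfiniteDiameter (HomogeneousDynamics.filledJulia U V)
        (‖HomogeneousDynamics.formResultant d U V‖ ^ (-1 / ((d : ℝ) * ((d : ℝ) - 1))))) ∧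
    (∀ (p : ℕ) [Fact p.Prime] (d : ℕ) (U V : MvPolynomial (Fin 2) (PadicComplex p)), 2 ≤ d →
      U.IsHomogeneous d → V.IsHomogeneous d →
      (∀ z : Fin 2 → PadicComplex p,
        MvPolynomial.eval z U = 0 → MvPolynomial.eval z V = 0 → z = 0) →
      HomogeneousDynamics.HasTransfiniteDiameter (HomogeneousDynamics.filledJulia U V)
        (‖HomogeneousDynamics.formResultant d U V‖ ^ (-1 / ((d : ℝ) * ((d : ℝ) - 1))))) := by
  refine ⟨fun d U V hd hU hV h0 => ?_, fun p _ d U V hd hU hV h0 => ?_⟩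
  · refine HomogeneousDynamics.hasTransfiniteDiameter_filledJulia (fun n hn => ?_)
      (HomogeneousDynamics.exists_norm_le_of_nontriviallyNormed ℂ) hd hU hV h0
    have : (1 : ℝ) ≤ n := by exact_mod_cast Nat.one_le_iff_ne_zero.2 hn
    rw [Complex.norm_natCast]
    nlinarith
  · exact HomogeneousDynamics.hasTransfiniteDiameter_filledJulia
      (HomogeneousDynamics.one_le_mul_norm_natCast_padicComplex p)
      (HomogeneousDynamics.exists_norm_le_of_nontriviallyNormed (PadicComplex p)) hd hU hV h0
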